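/- **Setting.** Let $n\ge 2$, $1\le p\le n$, $p+1\le m\le 2n$, $\mathcal X\subseteq\mathbb R^n$ and $f:\mathbb R^n\to\mathbb R$. Let $\delta_0,\varepsilon_f>0$, $\gamma>2$, $0<\tau<\sqrt{(\gamma-2)/(\gamma+2)}$, $j_{\max}\in\mathbb N$, $\delta_{\max}=\tau^{-j_{\max}}\delta_0$. All random objects live on one probability space $(\Omega,\mathcal F,\mathbb P)$. *The StoDARS process.* For $t\in\mathbb N=\{0,1,2,\dots\}$ let $\tilde U_t\in\mathbb O(n)$ be Haar-distributed random orthogonal matrices whose submatrices $\tilde U_{t,n\times p}$ of the first $p$ columns are independent, and let $\tilde D_t\in\mathbb R^{p\times m}$ be independent random matrices whose columns are unit vectors that positively span $\mathbb R^p$; the sequences $(\tilde U_{t,n\times p})_t$ and $(\tilde D_t)_t$ are independent of each other. Assume that for some $\alpha_Q,\beta_Q\in(0,1/2)$ one has $\mathbb P(\|\sqrt{n/p}\,\tilde U_{t,n\times p}^{\top}v\|\ge\alpha_Q\|v\|)\ge 1-\beta_Q$ for all $t$ and all $v\in\mathbb R^n$. Start from a deterministic $x_0\in\mathcal X$, the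 stepsize $\delta_0$, $\ell_0=0$ and $t_0=0$. At iteration $k$ put $U_k=\tilde U_{t_k,n\times p}$, $Q_k=\sqrt{n/p}\,U_k$, $D_k=\tilde D_{t_k}$, let $d_k^j$ be the $j$-th column of $D_k$, and let $u_k^j=U_kd_k^j$, $1\le j\le m$, be the poll directions. Real random variables $f_k(0)$ and $f_k(u_k^j)$, the estimates of $f(x_k)$ and $f(x_k+\delta_ku_k^j)$, are observed. The iteration is *successful* if some $j$ satisfies $x_k+\delta_ku_k^j\in\mathcal X$ and $f_k(u_k^j)-f_k(0)\le-\gamma\varepsilon_f\delta_k^2$; then $x_{k+1}=x_k+\delta_ku_k^j$ for some such $j$, $\delta_{k+1}=\min\{\tau^{-1}\delta_k,\delta_{\max}\}$ and $\ell_{k+1}=\ell_k-1$. Otherwise it is *unsuccessful* and $x_{k+1}=x_k$, $\delta_{k+1}=\tau\delta_k$, $\ell_{k+1}=\ell_k+1$. Finally, $t_{k+1}=\ell_{k+1}$ if $\ell_{k+1}\ge\max_{i\le k}\ell_i$, and $t_{k+1}=1+\max_{i\le k}t_i$ otherwise. Let $\mathcal F_{k-1}$ be the $\sigma$-algebra generated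 by the estimates and the entries of $Q_i,D_i$ for $i\le k-1$ (trivial for $k=0$), and $\mathcal F_{k-1}^{Q\cdot D}=\mathcal F_{k-1}\vee\sigma(Q_k,D_k)$; $x_k$ is $\mathcal F_{k-1}$-measurable. Let $K_\infty$ be the random set of unsuccessful iterations. *Assumptions.* $f$ is bounded below and locally Lipschitz. There are $\nu,\beta_f\in(0,1)$ with $\frac{\nu}{1-\nu}\ge\frac{2(\tau^{-2}-1)}{\gamma-2}$ and $\frac{\beta_f}{1-\beta_f}\ge\frac{4\nu}{(1-\nu)(1-\tau^2)}$ such that, almost surely for every $k$: * conditionally on $\mathcal F_{k-1}^{Q\cdot D}$, with probability at least $\beta_f$, the error of $f_k(0)$ and the errors of all $f_k(u_k^j)$, $1\le j\le m$, are at most $\varepsilon_f\delta_k^2$ in absolute value; * $\mathbb E[|f_k(0)-f(x_k)|^2\mid\mathcal F_{k-1}^{Q\cdot D}]\le\varepsilon_f^2(1-\beta_f)\delta_k^4$ and, for every random poll direction $u=u_k^{J}$ (with $J$ a random index), $\mathbb E[|f_k(u)-f(x_k+\delta_ku)|^2\mid\mathcal F_{k-1}^{Q\cdot D}]\le\varepsilon_f^2(1-\beta_f)\delta_k^4$.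 *Nonsmooth notions.* For $x\in\mathcal X$, the hypertangent cone $T^H_{\mathcal X}(x)$ is the set of $u\in\mathbb R^n$ for which there is $\varepsilon>0$ with $y+hv\in\mathcal X$ for all $y\in\mathcal X\cap B(x,\varepsilon)$, $v\in B(u,\varepsilon)$, $0<h<\varepsilon$. The Clarke–Jahn derivative is $$f^\circ(x;v)=\limsup_{\substack{y\to x,\ y\in\mathcal X\\ h\searrow0,\ y+hv\in\mathcal X}}\frac{f(y+hv)-f(y)}{h}.$$ The point $x\in\mathcal X$ is *Clarke stationary* if $f^\circ(x;u)\ge0$ for every $u\in T^H_{\mathcal X}(x)$. **Theorem (ClarkeTheor).** Under these assumptions: 1. Almost surely $\{t_k:k\in K_\infty\}=\mathbb N$. Moreover, let $K\subseteq K_\infty$ be a random infinite set of iterations such that $(x_k)_{k\in K}$ is a convergent refining subsequence: almost surely $\lim_{k\in K}\delta_k=0$ and $\lim_{k\in K}x_k=\hat x\in\mathcal X$. Then: 2. If $\hat u$ is the almost sure limit of poll directions $u_k\in\{u_k^1,\dots,u_k^m\}$ along $k\in L$, for a random infinite set $L\subseteq K$, and $\hat u\in T^H_{\mathcal X}(\hat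 x)$ almost surely, then $f^\circ(\hat x;\hat u)\ge0$ almost surely. 3. If almost surely $\{t_k:k\in K\}$ contains all but finitely many elements of $\mathbb N$ (as $K=K_\infty$ does by 1), then for every random unit vector $\hat u$ with $\hat u\in T^H_{\mathcal X}(\hat x)$ almost surely one has $f^\circ(\hat x;\hat u)\ge0$ almost surely; and almost surely $\hat x$ is Clarke stationary. -/

import Mathlib

open MeasureTheory ProbabilityTheory Filter Topology

noncomputable section

/-- The Euclidean space `ℝⁿ`. -/
abbrev Vec (n : ℕ) : Type := EuclideanSpace ℝ (Fin n)

/-! ### Nonsmooth analysis -/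

/-- The hypertangent cone to `X` at `x` (meaningful for `x ∈ X`). -/
def hypertangentCone {n : ℕ} (X : Set (Vec n)) (x : Vec n) : Set (Vec n) :=
  {u | ∃ ε : ℝ, 0 < ε ∧ ∀ y ∈ X ∩ Metric.ball x ε, ∀ v ∈ Metric.ball u ε,
    ∀ h : ℝ, 0 < h → h < ε → y + h • v ∈ X}

/-- The Clarke--Jahn generalized derivative `f°(x; v)` relative to `X`: the upper limit, in the
extended reals, of `(f (y + h v) - f y) / h` as `y → x` with `y ∈ X` and `h ↘ 0` with
`y + h v ∈ X`. -/
def clarkeJahn {n : ℕ} (f : Vec n → ℝ) (X : Set (Vec n)) (x v : Vec n) : EReal :=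
  limsup (fun z : Vec n × ℝ => (((f (z.1 + z.2 • v) - f z.1) / z.2 : ℝ) : EReal))
    ((𝓝[X] x ×ˢ 𝓝[>] (0 : ℝ)) ⊓ 𝓟 {z : Vec n × ℝ | z.1 + z.2 • v ∈ X})

/-- `x ∈ X` is Clarke stationary for the minimization of `f` over `X`: the generalized derivative
is nonnegative in every direction that is hypertangent to `X` at `x`. -/
def IsClarkeStationary {n : ℕ} (f : Vec n → ℝ) (X : Set (Vec n)) (x : Vec n) : Prop :=
  x ∈ X ∧ ∀ u ∈ hypertangentCone X x, 0 ≤ clarkeJahn f X x u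

/-! ### Random matrices -/

/-- Real matrices carry the product (entrywise) `σ`-algebra, which is their Borel `σ`-algebra. -/
instance instMeasurableSpaceRealMatrix (a b : ℕ) : MeasurableSpace (Matrix (Fin a) (Fin b) ℝ) :=
  inferInstanceAs (MeasurableSpace (Fin a → Fin b → ℝ))

instance instBorelSpaceRealMatrix (a b : ℕ) : BorelSpace (Matrix (Fin a) (Fin b) ℝ) :=
  inferInstanceAs (BorelSpace (Fin a → Fin b → ℝ))

/-- A random orthogonal matrix is Haar-distributed if its law is the Haar probability measure of
the orthogonal group `O(n)`. -/
def HaarDistributed {Ω : Type*} [MeasurableSpace Ω] {n : ℕ}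
    (U : Ω → Matrix.orthogonalGroup (Fin n) ℝ) (P : Measure Ω) : Prop :=
  Measurable U ∧ (P.map U).IsHaarMeasure

/-- The matrix consisting of the first `p` columns of an `n × n` matrix (`p ≤ n`). -/
def firstColumns {n p : ℕ} (hp : p ≤ n) (A : Matrix (Fin n) (Fin n) ℝ) :
    Matrix (Fin n) (Fin p) ℝ :=
  A.submatrix id (Fin.castLE hp)

/-- `Q` is `(1 - β)`-probabilistically `α`-well aligned: `P (‖Qᵀ v‖ ≥ α ‖v‖) ≥ 1 - β`
for every `v ∈ ℝⁿ`. -/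
def WellAligned {Ω : Type*} [MeasurableSpace Ω] {n p : ℕ}
    (Q : Ω → Matrix (Fin n) (Fin p) ℝ) (α β : ℝ) (P : Measure Ω) : Prop :=
  ∀ v : Vec n, 1 - β ≤ P.real
    {ω | α * ‖v‖ ≤ ‖(WithLp.toLp 2 ((Q ω).transpose.mulVec (WithLp.ofLp v)) : Vec p)‖}

/-- The columns of `D` form a positive spanning set of `ℝᵖ`: every vector is a nonnegative linear
combination of them. -/
def ColumnsPositivelySpan {p m : ℕ} (D : Matrix (Fin p) (Fin m) ℝ) : Prop :=
  ∀ v : Fin p → ℝ, ∃ c : Fin m → ℝ, (∀ j, 0 ≤ c j) ∧ D.mulVec c = v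

/-- The columns of `D` lie on the unit sphere of `ℝᵖ`. -/
def ColumnsUnit {p m : ℕ} (D : Matrix (Fin p) (Fin m) ℝ) : Prop :=
  ∀ j, ‖(WithLp.toLp 2 (D.col j) : Vec p)‖ = 1

/-! ### The StoDARS algorithm -/

/-- Dimensions and user parameters of the StoDARS algorithm. -/
structure StoDARSParams (n p m : ℕ) where
  δ₀ : ℝ
  εf : ℝ
  γ : ℝ
  τ : ℝ
  jmax : ℕ
  two_le_n : 2 ≤ n
  one_le_p : 1 ≤ p
  p_le_n : p ≤ n
  p_lt_m : p + 1 ≤ m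
  m_le : m ≤ 2 * n
  δ₀_pos : 0 < δ₀
  εf_pos : 0 < εf
  two_lt_γ : 2 < γ
  τ_pos : 0 < τ
  τ_lt : τ < Real.sqrt ((γ - 2) / (γ + 2))

/-- The maximal stepsize `τ ^ (-jmax) * δ₀`. -/
def StoDARSParams.δmax {n p m : ℕ} (par : StoDARSParams n p m) : ℝ :=
  (par.τ ^ par.jmax)⁻¹ * par.δ₀

/-- The random quantities handled by the algorithm, all on one sample space:
* `U t`, `D t`: the generated orthogonal matrices and the matrices of subspace directions, listed
  by the matrix index `t`;
* `est₀ k`, `est k j`: the estimates, at iteration `k`, of `f` at the incumbent and at the trial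
  point given by the `j`-th poll direction;
* `x k`, `δ k`: incumbent and stepsize; `ℓ k`: the counter (`+1` on failure, `-1` on success);
  `t k`: the index of the matrices used at iteration `k`.
The rules that tie them together are in `IsStoDARS`. -/
structure StoDARSProcess (Ω : Type*) (n p m : ℕ) where
  U : ℕ → Ω → Matrix.orthogonalGroup (Fin n) ℝ
  D : ℕ → Ω → Matrix (Fin p) (Fin m) ℝ
  est₀ : ℕ → Ω → ℝ
  est : ℕ → Fin m → Ω → ℝ
  x : ℕ → Ω → Vec n
  δ : ℕ → Ω → ℝ
  ℓ : ℕ → Ω → ℤ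
  t : ℕ → Ω → ℕ

namespace StoDARSProcess

variable {Ω : Type*} {n p m : ℕ}

/-- The matrix with `p` orthonormal columns used for polling at iteration `k`. -/
def Uk (S : StoDARSProcess Ω n p m) (hp : p ≤ n) (k : ℕ) (ω : Ω) : Matrix (Fin n) (Fin p) ℝ :=
  firstColumns hp (S.U (S.t k ω) ω : Matrix (Fin n) (Fin n) ℝ)

/-- The rescaled matrix `√(n/p) U` of iteration `k`. -/
def Qk (S : StoDARSProcess Ω n p m) (hp : p ≤ n) (k : ℕ) (ω : Ω) : Matrix (Fin n) (Fin p) ℝ :=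
  Real.sqrt ((n : ℝ) / p) • S.Uk hp k ω

/-- The matrix whose columns are the subspace directions of iteration `k`. -/
def Dk (S : StoDARSProcess Ω n p m) (k : ℕ) (ω : Ω) : Matrix (Fin p) (Fin m) ℝ :=
  S.D (S.t k ω) ω

/-- The `j`-th poll direction of iteration `k`: the image under `Uk` of the `j`-th column
of `Dk`. -/
def pollDir (S : StoDARSProcess Ω n p m) (hp : p ≤ n) (k : ℕ) (j : Fin m) (ω : Ω) : Vec n :=
  WithLp.toLp 2 ((S.Uk hp k ω).mulVec ((S.Dk k ω).col j))

/-- The `j`-th trial point of iteration `k`. -/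
def pollPoint (S : StoDARSProcess Ω n p m) (hp : p ≤ n) (k : ℕ) (j : Fin m) (ω : Ω) : Vec n :=
  S.x k ω + S.δ k ω • S.pollDir hp k j ω

/-- The `j`-th trial point of iteration `k` is feasible and its estimate passes the sufficient
decrease test. -/
def Acceptable (S : StoDARSProcess Ω n p m) (par : StoDARSParams n p m) (X : Set (Vec n))
    (k : ℕ) (j : Fin m) (ω : Ω) : Prop :=
  S.pollPoint par.p_le_n k j ω ∈ X ∧
    S.est k j ω - S.est₀ k ω ≤ -par.γ * par.εf * S.δ k ω ^ 2

/-- Iteration `k` is successful. -/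
def Success (S : StoDARSProcess Ω n p m) (par : StoDARSParams n p m) (X : Set (Vec n))
    (k : ℕ) (ω : Ω) : Prop :=
  ∃ j, S.Acceptable par X k j ω

/-- The random set of all unsuccessful iterations. -/
def unsuccessful (S : StoDARSProcess Ω n p m) (par : StoDARSParams n p m) (X : Set (Vec n))
    (ω : Ω) : Set ℕ :=
  {k | ¬ S.Success par X k ω}

/-- The `σ`-algebra of the iterations before `k`, generated by the estimates and the entries of
the polling matrices of the iterations `0, …, k - 1` (trivial for `k = 0`). -/
@[reducible]
def history (S : StoDARSProcess Ω n p m) (hp : p ≤ n) (k : ℕ) : MeasurableSpace Ω :=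
  ⨆ i : Fin k,
    (MeasurableSpace.comap (S.est₀ i) inferInstance ⊔
      (⨆ j : Fin m, MeasurableSpace.comap (S.est i j) inferInstance) ⊔
      MeasurableSpace.comap (S.Qk hp i) inferInstance ⊔
      MeasurableSpace.comap (S.Dk i) inferInstance)

/-- The `σ`-algebra of the iterations before `k` together with the polling matrices of
iteration `k`. -/
@[reducible]
def pollHistory (S : StoDARSProcess Ω n p m) (hp : p ≤ n) (k : ℕ) : MeasurableSpace Ω :=
  S.history hp k ⊔ MeasurableSpace.comap (S.Qk hp k) inferInstance ⊔
    MeasurableSpace.comap (S.Dk k) inferInstance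

end StoDARSProcess

/-- `S` is a run of the StoDARS algorithm with parameters `par` for the feasible set `X`, on the
probability space `(Ω, P)`. -/
structure IsStoDARS {Ω : Type*} [MeasurableSpace Ω] {n p m : ℕ} (par : StoDARSParams n p m)
    (X : Set (Vec n)) (P : Measure Ω) (S : StoDARSProcess Ω n p m) : Prop where
  /-- Generation of the matrices: Haar-distributed orthogonal matrices whose `n × p` blocks are
  independent, and independent matrices of subspace directions, the two sequences being
  independent of each other. -/
  haar : ∀ t, HaarDistributed (S.U t) P
  indep_U : iIndepFun (fun t ω => firstColumns par.p_le_n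
    (S.U t ω : Matrix (Fin n) (Fin n) ℝ)) P
  measurable_D : ∀ t, Measurable (S.D t)
  indep_D : iIndepFun S.D P
  indep_U_D : IndepFun (fun ω t => firstColumns par.p_le_n
    (S.U t ω : Matrix (Fin n) (Fin n) ℝ)) (fun ω t => S.D t ω) P
  /-- The rescaled blocks are probabilistically well aligned. -/
  wellAligned : ∃ αQ βQ : ℝ, 0 < αQ ∧ αQ < 1 / 2 ∧ 0 < βQ ∧ βQ < 1 / 2 ∧ ∀ t,
    WellAligned (fun ω => Real.sqrt ((n : ℝ) / p) •
      firstColumns par.p_le_n (S.U t ω : Matrix (Fin n) (Fin n) ℝ)) αQ βQ P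
  /-- The subspace directions are unit vectors forming a positive spanning set. -/
  unit_D : ∀ t ω, ColumnsUnit (S.D t ω)
  span_D : ∀ t ω, ColumnsPositivelySpan (S.D t ω)
  /-- The estimates are random variables. -/
  measurable_est₀ : ∀ k, Measurable (S.est₀ k)
  measurable_est : ∀ k j, Measurable (S.est k j)
  /-- Initialization, at a deterministic feasible point. -/
  x_zero : ∃ x₀ ∈ X, ∀ ω, S.x 0 ω = x₀
  δ_zero : ∀ ω, S.δ 0 ω = par.δ₀
  ℓ_zero : ∀ ω, S.ℓ 0 ω = 0
  t_zero : ∀ ω, S.t 0 ω = 0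
  /-- Successful iterations: the incumbent moves to some acceptable trial point. -/
  x_success : ∀ k ω, S.Success par X k ω →
    ∃ j, S.Acceptable par X k j ω ∧ S.x (k + 1) ω = S.pollPoint par.p_le_n k j ω
  δ_success : ∀ k ω, S.Success par X k ω →
    S.δ (k + 1) ω = min (par.τ⁻¹ * S.δ k ω) par.δmax
  ℓ_success : ∀ k ω, S.Success par X k ω → S.ℓ (k + 1) ω = S.ℓ k ω - 1
  /-- Unsuccessful iterations. -/
  x_failure : ∀ k ω, ¬ S.Success par X k ω → S.x (k + 1) ω = S.x k ω
  δ_failure : ∀ k ω, ¬ S.Success par X k ω → S.δ (k + 1) ω = par.τ * S.δ k ω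
  ℓ_failure : ∀ k ω, ¬ S.Success par X k ω → S.ℓ (k + 1) ω = S.ℓ k ω + 1
  /-- Update of the matrix index. -/
  t_record : ∀ k ω, (∀ i ≤ k, S.ℓ i ω ≤ S.ℓ (k + 1) ω) → (S.t (k + 1) ω : ℤ) = S.ℓ (k + 1) ω
  t_fresh : ∀ k ω, ¬ (∀ i ≤ k, S.ℓ i ω ≤ S.ℓ (k + 1) ω) →
    S.t (k + 1) ω = 1 + (Finset.range (k + 1)).sup (fun i => S.t i ω)
  /-- The incumbent of iteration `k` is determined by the information available before
  iteration `k` (in particular, the choice among acceptable trial points is not anticipative). -/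
  adapted : ∀ k, Measurable[S.history par.p_le_n k] (S.x k)

/-! ### Quality of the estimates -/

/-- The event that, at iteration `k`, the estimates at the incumbent and at all trial points are
`εf`-accurate. -/
def accurateEvent {Ω : Type*} {n p m : ℕ} (par : StoDARSParams n p m) (f : Vec n → ℝ)
    (S : StoDARSProcess Ω n p m) (k : ℕ) : Set Ω :=
  {ω | |S.est₀ k ω - f (S.x k ω)| ≤ par.εf * S.δ k ω ^ 2 ∧
    ∀ j, |S.est k j ω - f (S.pollPoint par.p_le_n k j ω)| ≤ par.εf * S.δ k ω ^ 2}

/-- The estimates are `β`-probabilistically `εf`-accurate. -/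
def ProbabilisticallyAccurate {Ω : Type*} [MeasurableSpace Ω] {n p m : ℕ}
    (par : StoDARSParams n p m) (f : Vec n → ℝ) (β : ℝ) (P : Measure Ω)
    (S : StoDARSProcess Ω n p m) : Prop :=
  ∀ k, ∀ᵐ ω ∂P, β ≤ (P⟦accurateEvent par f S k | S.pollHistory par.p_le_n k⟧) ω

/-- The variance conditions: conditionally on `pollHistory`, the mean squared errors of the
estimates at the incumbent and at any (possibly random) trial point, the one with index `J ω`,
are at most `εf² (1 - β) δ_k⁴`. -/
def VarianceCondition {Ω : Type*} [MeasurableSpace Ω] {n p m : ℕ}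
    (par : StoDARSParams n p m) (f : Vec n → ℝ) (β : ℝ) (P : Measure Ω)
    (S : StoDARSProcess Ω n p m) : Prop :=
  ∀ k,
    (Integrable (fun ω => |S.est₀ k ω - f (S.x k ω)| ^ 2) P ∧
      ∀ᵐ ω ∂P, (P[fun ω => |S.est₀ k ω - f (S.x k ω)| ^ 2 | S.pollHistory par.p_le_n k]) ω ≤
        par.εf ^ 2 * (1 - β) * S.δ k ω ^ 4) ∧
    ∀ J : Ω → Fin m, Measurable J →
      (Integrable (fun ω => |S.est k (J ω) ω - f (S.pollPoint par.p_le_n k (J ω) ω)| ^ 2) P ∧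
        ∀ᵐ ω ∂P, (P[fun ω => |S.est k (J ω) ω - f (S.pollPoint par.p_le_n k (J ω) ω)| ^ 2 |
            S.pollHistory par.p_le_n k]) ω ≤
          par.εf ^ 2 * (1 - β) * S.δ k ω ^ 4)

/-! ### Refining subsequences -/

/-- The limit along the indices `k ∈ K` going to infinity. -/
def alongSet (K : Set ℕ) : Filter ℕ := atTop ⊓ 𝓟 K

/-- Almost surely, `K` is an infinite set of unsuccessful iterations along which the stepsizes
tend to zero: `(x_k)_{k ∈ K}` is a refining subsequence. -/
def IsRefiningSubsequence {Ω : Type*} [MeasurableSpace Ω] {n p m : ℕ}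
    (par : StoDARSParams n p m) (X : Set (Vec n)) (P : Measure Ω)
    (S : StoDARSProcess Ω n p m) (K : Ω → Set ℕ) : Prop :=
  ∀ᵐ ω ∂P, K ω ⊆ S.unsuccessful par X ω ∧ (K ω).Infinite ∧
    Tendsto (fun k => S.δ k ω) (alongSet (K ω)) (𝓝 0)

/-- Almost surely, `(x_k)_{k ∈ K}` converges to `xhat ∈ X`. -/
def ConvergesAlong {Ω : Type*} [MeasurableSpace Ω] {n p m : ℕ} (X : Set (Vec n)) (P : Measure Ω)
    (S : StoDARSProcess Ω n p m) (K : Ω → Set ℕ) (xhat : Ω → Vec n) : Prop :=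
  ∀ᵐ ω ∂P, xhat ω ∈ X ∧ Tendsto (fun k => S.x k ω) (alongSet (K ω)) (𝓝 (xhat ω))

/-- Almost surely, the indices of the matrices used at the iterations in `K` exhaust
`{0, 1, 2, …}` up to finitely many. -/
def ExhaustsMatrices {Ω : Type*} [MeasurableSpace Ω] {n p m : ℕ} (P : Measure Ω)
    (S : StoDARSProcess Ω n p m) (K : Ω → Set ℕ) : Prop :=
  ∀ᵐ ω ∂P, {s : ℕ | ∀ k ∈ K ω, S.t k ω ≠ s}.Finite

end

/-! The result is pathwise once three almost sure facts are known: the stepsizes δ_k tend to 0, the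
estimation errors are o(δ_k), and the poll directions met along K are dense in the unit sphere.

The first two come from the merit function Φ_k = (ν/ε_f)(f(x_k) − b) + (1 − ν)δ_k², with b a lower
bound of f. `merit_change_le` bounds its change over one iteration deterministically. In
expectation, the accuracy and variance conditions leave a decrease of at least a fixed multiple of E
δ_k² (`integral_merit_succ_le`). Since Φ is nonnegative, Σ E δ_k² is finite, so δ_k → 0. The
variance bound divided by δ_k² is again of order E δ_k², so the squared ratios error/δ_k are
summable in mean and tend to 0 (`ae_tendsto_zero`).

Once δ_k stays below its cap, it is a constant times τ^ℓ_k, so ℓ is unbounded above. Its first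
passage from s to s + 1 starts at a record value s, where t_k = s, and is a failure; this gives part
1.

For density, invariance and uniqueness of Haar measure bound P(‖U d − v‖ < ε) below, uniformly in
the matrix index and in the unit vectors d and v. With the matrices D frozen, the independent blocks
satisfy the second Borel–Cantelli lemma. Exhaustion of the indices carries the resulting infinitely
many matrices over to iterations in K.

At an unsuccessful iteration the failed decrease test bounds f(x_k + δ_k u) − f(x_k) below by
−o(δ_k) at every feasible trial point. Hypertangency makes the trial points feasible, and the
Lipschitz property replaces their directions by the limit direction
(`clarkeJahn_nonneg_of_tendsto`). -/

noncomputable section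

/-! ### Nonnegativity of the generalized derivative from difference quotients along a filter -/

/-- If the difference quotients of `f` at points `y i → x` of `X`, with steps `h i ↘ 0` and
directions `w i → u`, are bounded below by a null family whenever the end points lie in `X`,
then the generalized derivative in the hypertangent direction `u` is nonnegative. -/
theorem clarkeJahn_nonneg_of_tendsto {n : ℕ} {f : Vec n → ℝ} {X : Set (Vec n)} {x u : Vec n}
    (hf : LocallyLipschitz f) (hu : u ∈ hypertangentCone X x)
    {ι : Type*} {F : Filter ι} [F.NeBot] {y w : ι → Vec n} {h η : ι → ℝ}
    (hyX : ∀ i, y i ∈ X) (hy : Tendsto y F (𝓝 x)) (hpos : ∀ i, 0 < h i)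
    (hh : Tendsto h F (𝓝 0)) (hw : Tendsto w F (𝓝 u)) (hη : Tendsto η F (𝓝 0))
    (hq : ∀ᶠ i in F, y i + h i • w i ∈ X → η i * h i ≤ f (y i + h i • w i) - f (y i)) :
    0 ≤ clarkeJahn f X x u := by
  obtain ⟨ε, hε, hcone⟩ := hu
  obtain ⟨C, V, hV, hlip⟩ := hf x
  have hyb : ∀ᶠ i in F, y i ∈ Metric.ball x ε := hy (Metric.ball_mem_nhds x hε)
  have hwb : ∀ᶠ i in F, w i ∈ Metric.ball u ε := hw (Metric.ball_mem_nhds u hε)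
  have hhb : ∀ᶠ i in F, h i < ε := hh.eventually (gt_mem_nhds hε)
  have hend : ∀ z : ι → Vec n, ∀ b : Vec n, Tendsto z F (𝓝 b) →
      Tendsto (fun i => y i + h i • z i) F (𝓝 x) := by
    intro z b hz
    simpa using hy.add (hh.smul hz)
  -- The limsup uses the fixed direction u, not w i; hypertangency also puts y i + h i • u in X.
  have hphi : Tendsto (fun i => (y i, h i)) F
      ((𝓝[X] x ×ˢ 𝓝[>] (0 : ℝ)) ⊓ 𝓟 {z : Vec n × ℝ | z.1 + z.2 • u ∈ X}) := by
    refine tendsto_inf.2 ⟨?_, ?_⟩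
    · refine Tendsto.prodMk ?_ ?_
      · exact tendsto_nhdsWithin_iff.2 ⟨hy, Eventually.of_forall hyX⟩
      · exact tendsto_nhdsWithin_iff.2 ⟨hh, Eventually.of_forall hpos⟩
    · rw [tendsto_principal]
      filter_upwards [hyb, hhb] with i h1 h2
      exact hcone _ ⟨hyX i, h1⟩ u (Metric.mem_ball_self hε) _ (hpos i) h2
  have hlow : Tendsto (fun i => η i - C * ‖w i - u‖) F (𝓝 0) := by
    have h1 : Tendsto (fun i => ‖w i - u‖) F (𝓝 0) := tendsto_iff_norm_sub_tendsto_zero.1 hw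
    simpa using hη.sub (h1.const_mul (C : ℝ))
  -- Passing from w i to u costs at most C‖w i − u‖ in the quotient.
  have hge : ∀ᶠ i in F, η i - C * ‖w i - u‖ ≤ (f (y i + h i • u) - f (y i)) / h i := by
    filter_upwards [hyb, hwb, hhb, hq, (hend w u hw) hV,
      (hend (fun _ => u) u tendsto_const_nhds) hV] with i h1 h2 h3 h4 h5 h6
    have h7 := h4 (hcone _ ⟨hyX i, h1⟩ _ h2 _ (hpos i) h3)
    have h8 := hlip.dist_le_mul _ h5 _ h6
    rw [Real.dist_eq, dist_add_left, dist_eq_norm, ← smul_sub, norm_smul, Real.norm_eq_abs,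
      abs_of_pos (hpos i)] at h8
    rw [le_div_iff₀ (hpos i)]
    have h9 := (abs_le.1 h8).2
    nlinarith
  set g : Vec n × ℝ → EReal :=
    fun z => (((f (z.1 + z.2 • u) - f z.1) / z.2 : ℝ) : EReal) with hg
  have hlim : Tendsto (fun i => ((η i - C * ‖w i - u‖ : ℝ) : EReal)) F (𝓝 ((0 : ℝ) : EReal)) :=
    (continuous_coe_real_ereal.tendsto 0).comp hlow
  calc (0 : EReal) = limsup (fun i => ((η i - C * ‖w i - u‖ : ℝ) : EReal)) F := by
        rw [hlim.limsup_eq]; rfl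
    _ ≤ limsup (fun i => g (y i, h i)) F := by
        refine limsup_le_limsup ?_
        filter_upwards [hge] with i hi
        exact EReal.coe_le_coe_iff.2 hi
    _ = limsup g (map (fun i => (y i, h i)) F) := rfl
    _ ≤ clarkeJahn f X x u := limsup_le_limsup_of_le hphi

/-! ### Integer walks with unit steps and the matrix indices -/

/-- An integer sequence started at `0` which never increases by more than one and is unbounded
above reaches `s + 1` for the first time by a step from `s`. -/
theorem exists_first_passage {ℓ : ℕ → ℤ} (h0 : ℓ 0 = 0) (hstep : ∀ k, ℓ (k + 1) ≤ ℓ k + 1)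
    (hunb : ∀ B : ℤ, ∃ k, B ≤ ℓ k) (s : ℕ) :
    ∃ k, ℓ k = s ∧ ℓ (k + 1) = s + 1 ∧ ∀ i ≤ k, ℓ i ≤ s := by
  classical
  have hex := hunb (s + 1)
  -- The first time at level s + 1 or above is not 0, so it has a predecessor; upward steps of size
  -- at most one force the value s there.
  obtain ⟨k, hk⟩ : ∃ k, Nat.find hex = k + 1 := by
    refine Nat.exists_eq_succ_of_ne_zero fun h => ?_
    have := Nat.find_spec hex
    rw [h, h0] at this
    omega
  have h1 := Nat.find_spec hex
  rw [hk] at h1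
  have hle : ∀ i ≤ k, ℓ i ≤ s := by
    intro i hi
    have := Nat.find_min hex (m := i) (by omega)
    omega
  have := hle k le_rfl
  have := hstep k
  exact ⟨k, by omega, by omega, hle⟩

/-! ### Stepsize bounds and coverage of the matrix indices -/

namespace StoDARSParams

variable {n p m : ℕ} (par : StoDARSParams n p m)

theorem sqrt_lt_one : Real.sqrt ((par.γ - 2) / (par.γ + 2)) < 1 := by
  have := par.two_lt_γ
  rw [Real.sqrt_lt' one_pos, one_pow, div_lt_one (by linarith)]
  linarith

theorem τ_lt_one : par.τ < 1 := par.τ_lt.trans par.sqrt_lt_one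

theorem δmax_pos : 0 < par.δmax := mul_pos (inv_pos.2 (pow_pos par.τ_pos _)) par.δ₀_pos

theorem δ₀_le_δmax : par.δ₀ ≤ par.δmax :=
  le_mul_of_one_le_left par.δ₀_pos.le
    ((one_le_inv₀ (pow_pos par.τ_pos _)).2 (pow_le_one₀ par.τ_pos.le par.τ_lt_one.le))

end StoDARSParams

namespace IsStoDARS

variable {Ω : Type*} [MeasurableSpace Ω] {P : Measure Ω} {n p m : ℕ} {par : StoDARSParams n p m}
  {X : Set (Vec n)} {S : StoDARSProcess Ω n p m}

/-- The deterministic lower bound makes δ_k⁻² bounded for each fixed k, so that it can be pulled out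
of conditional expectations. -/
theorem δ_bounds (hS : IsStoDARS par X P S) (k : ℕ) (ω : Ω) :
    par.τ ^ k * par.δ₀ ≤ S.δ k ω ∧ S.δ k ω ≤ par.δmax := by
  have hτ := par.τ_pos
  have hτ1 := par.τ_lt_one
  induction k with
  | zero => simpa [hS.δ_zero ω] using par.δ₀_le_δmax
  | succ k ih =>
    have hp : 0 < S.δ k ω := (mul_pos (pow_pos hτ k) par.δ₀_pos).trans_le ih.1
    have hle : par.τ ^ (k + 1) * par.δ₀ ≤ par.τ * S.δ k ω := by
      rw [pow_succ', mul_assoc]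
      exact mul_le_mul_of_nonneg_left ih.1 hτ.le
    by_cases h : S.Success par X k ω
    · rw [hS.δ_success k ω h]
      refine ⟨le_min (hle.trans ?_) ?_, min_le_right _ _⟩
      · have : 1 ≤ par.τ⁻¹ := (one_le_inv₀ hτ).2 hτ1.le
        nlinarith
      · refine le_trans ?_ par.δ₀_le_δmax
        exact mul_le_of_le_one_left par.δ₀_pos.le (pow_le_one₀ hτ.le hτ1.le)
    · rw [hS.δ_failure k ω h]
      exact ⟨hle, (mul_le_of_le_one_left hp.le hτ1.le).trans ih.2⟩

theorem δ_pos (hS : IsStoDARS par X P S) (k : ℕ) (ω : Ω) : 0 < S.δ k ω :=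
  (mul_pos (pow_pos par.τ_pos k) par.δ₀_pos).trans_le (hS.δ_bounds k ω).1

theorem x_mem (hS : IsStoDARS par X P S) (k : ℕ) (ω : Ω) : S.x k ω ∈ X := by
  induction k with
  | zero => obtain ⟨x₀, hx, h⟩ := hS.x_zero; rw [h]; exact hx
  | succ k ih =>
    by_cases h : S.Success par X k ω
    · obtain ⟨j, hj, h'⟩ := hS.x_success k ω h
      rw [h']; exact hj.1
    · rw [hS.x_failure k ω h]; exact ih

theorem ℓ_step (hS : IsStoDARS par X P S) (k : ℕ) (ω : Ω) :
    S.ℓ (k + 1) ω ≤ S.ℓ k ω + 1 := by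
  by_cases h : S.Success par X k ω
  · rw [hS.ℓ_success k ω h]; omega
  · rw [hS.ℓ_failure k ω h]

/-- While the stepsize is below its maximal value, the counter is minus its logarithm in base `τ`,
up to a constant. -/
theorem ℓ_unbounded (hS : IsStoDARS par X P S) {ω : Ω}
    (hδ : Tendsto (fun k => S.δ k ω) atTop (𝓝 0)) (B : ℤ) : ∃ k, B ≤ S.ℓ k ω := by
  have hτ := par.τ_pos
  obtain ⟨N, hN⟩ := eventually_atTop.1 (hδ.eventually (gt_mem_nhds par.δmax_pos))
  have hconst : ∀ k, S.δ (N + k) ω = par.τ ^ (S.ℓ (N + k) ω - S.ℓ N ω) * S.δ N ω := by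
    intro k
    induction k with
    | zero => simp
    | succ k ih =>
      have hlt := hN (N + k + 1) (by omega)
      rw [← add_assoc]
      by_cases h : S.Success par X (N + k) ω
      · have h1 := hS.δ_success _ ω h
        rw [h1] at hlt
        -- An active cap would give δ = δmax, excluded after time N.
        rw [min_eq_left (by
          by_contra hc
          rw [min_eq_right (not_le.1 hc).le] at hlt
          exact lt_irrefl _ hlt)] at h1
        rw [h1, ih, hS.ℓ_success _ ω h, show S.ℓ (N + k) ω - 1 - S.ℓ N ω
          = (S.ℓ (N + k) ω - S.ℓ N ω) - 1 by ring, zpow_sub_one₀ hτ.ne']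
        ring
      · rw [hS.δ_failure _ ω h, ih, hS.ℓ_failure _ ω h, show S.ℓ (N + k) ω + 1 - S.ℓ N ω
          = (S.ℓ (N + k) ω - S.ℓ N ω) + 1 by ring, zpow_add_one₀ hτ.ne']
        ring
  have hpos : 0 < par.τ ^ (B - S.ℓ N ω) * S.δ N ω :=
    mul_pos (zpow_pos hτ _) (hS.δ_pos N ω)
  obtain ⟨M, hM⟩ := eventually_atTop.1 (hδ.eventually (gt_mem_nhds hpos))
  have h1 := hM (N + M) (by omega)
  rw [hconst M] at h1
  have h2 := lt_of_mul_lt_mul_right h1 (hS.δ_pos N ω).le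
  have h3 := (zpow_lt_zpow_iff_right_of_lt_one₀ hτ par.τ_lt_one).1 h2
  exact ⟨N + M, by omega⟩

/-- If the stepsizes tend to zero, every matrix index is used by an unsuccessful iteration. -/
theorem exists_unsuccessful_index (hS : IsStoDARS par X P S) {ω : Ω}
    (hδ : Tendsto (fun k => S.δ k ω) atTop (𝓝 0)) (s : ℕ) :
    ∃ k ∈ S.unsuccessful par X ω, S.t k ω = s := by
  obtain ⟨k, hk, hk1, hmax⟩ := exists_first_passage (ℓ := fun k => S.ℓ k ω) (hS.ℓ_zero ω)
    (fun k => hS.ℓ_step k ω) (hS.ℓ_unbounded hδ) s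
  refine ⟨k, fun h => ?_, ?_⟩
  · have := hS.ℓ_success k ω h
    omega
  -- At k = 0 the value s is 0 and t starts at 0; otherwise ℓ_k = s is a record, so the record rule
  -- gives t_k = s.
  · cases k with
    | zero =>
      have := hS.ℓ_zero ω
      have := hS.t_zero ω
      omega
    | succ k =>
      have := hS.t_record k ω fun i hi => by
        have := hmax i (by omega)
        omega
      omega

end IsStoDARS

/-! ### Blocks of orthogonal matrices -/

/-- Turns the block acting on d into the full orthogonal matrix acting on a fixed vector of ℝⁿ,
where Haar invariance applies. -/
theorem firstColumns_eq_mul {n p : ℕ} (hp : p ≤ n) (A : Matrix (Fin n) (Fin n) ℝ) :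
    firstColumns hp A = A * firstColumns hp 1 := by
  ext i j
  simp [firstColumns, Matrix.mul_apply, Matrix.one_apply]

theorem transpose_firstColumns_mul_self {n p : ℕ} (hp : p ≤ n)
    (A : Matrix.orthogonalGroup (Fin n) ℝ) :
    (firstColumns hp (A : Matrix (Fin n) (Fin n) ℝ)).transpose *
      firstColumns hp (A : Matrix (Fin n) (Fin n) ℝ) = 1 := by
  have h := (Matrix.mem_orthogonalGroup_iff' (Fin n) ℝ).1 A.2
  ext i j
  have := congrFun (congrFun h (Fin.castLE hp i)) (Fin.castLE hp j)
  simp only [Matrix.mul_apply, Matrix.transpose_apply, Matrix.one_apply] at this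
  simp only [firstColumns, Matrix.mul_apply, Matrix.transpose_apply, Matrix.submatrix_apply, id,
    this, Matrix.one_apply, (Fin.castLE_injective hp).eq_iff]

theorem norm_mulVec_of_transpose_mul_self {a b : ℕ} {A : Matrix (Fin a) (Fin b) ℝ}
    (hA : A.transpose * A = 1) (v : Fin b → ℝ) :
    ‖(WithLp.toLp 2 (A.mulVec v) : Vec a)‖ = ‖(WithLp.toLp 2 v : Vec b)‖ := by
  have key : ∀ {c : ℕ} (w : Fin c → ℝ), ‖(WithLp.toLp 2 w : Vec c)‖ ^ 2 = dotProduct w w := by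
    intro c w
    rw [EuclideanSpace.norm_sq_eq]
    simp [dotProduct, sq]
  have h : ‖(WithLp.toLp 2 (A.mulVec v) : Vec a)‖ ^ 2 = ‖(WithLp.toLp 2 v : Vec b)‖ ^ 2 := by
    rw [key, key, Matrix.dotProduct_mulVec, Matrix.vecMul_mulVec, ← Matrix.dotProduct_mulVec, hA,
      Matrix.one_mulVec]
  exact (pow_left_inj₀ (norm_nonneg _) (norm_nonneg _) two_ne_zero).1 h

/-! ### Measurability -/

namespace StoDARSProcess

variable {Ω : Type*} {n p m : ℕ} (S : StoDARSProcess Ω n p m) (hp : p ≤ n)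

theorem history_mono : Monotone (S.history hp) := by
  intro k l hkl
  exact iSup_le fun i => le_iSup_of_le (⟨i, i.2.trans_le hkl⟩ : Fin l) le_rfl

theorem history_le_pollHistory (k : ℕ) : S.history hp k ≤ S.pollHistory hp k :=
  le_sup_left.trans le_sup_left

theorem measurable_Qk (k : ℕ) : Measurable[S.pollHistory hp k] (S.Qk hp k) :=
  (comap_measurable (S.Qk hp k)).mono (le_sup_right.trans le_sup_left) le_rfl

theorem measurable_Dk (k : ℕ) : Measurable[S.pollHistory hp k] (S.Dk k) :=
  (comap_measurable (S.Dk k)).mono le_sup_right le_rfl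

end StoDARSProcess

theorem measurable_matrix_apply {a b : ℕ} (i : Fin a) (j : Fin b) :
    Measurable fun A : Matrix (Fin a) (Fin b) ℝ => A i j :=
  (measurable_pi_apply j).comp (measurable_pi_apply (X := fun _ : Fin a => Fin b → ℝ) i)

theorem measurable_matrix_mul_mulVec_col {a b c : ℕ} (j : Fin c) :
    Measurable fun z : Matrix (Fin a) (Fin b) ℝ × Matrix (Fin b) (Fin c) ℝ =>
      (WithLp.toLp 2 (z.1.mulVec (z.2.col j)) : Vec a) := by
  refine (PiLp.continuous_toLp 2 _).measurable.comp (measurable_pi_lambda _ fun i => ?_)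
  simp only [Matrix.mulVec, dotProduct, Matrix.col_apply]
  refine Finset.measurable_sum _ fun l _ => ?_
  exact ((measurable_matrix_apply i l).comp measurable_fst).mul
    ((measurable_matrix_apply l j).comp measurable_snd)

namespace IsStoDARS

variable {Ω : Type*} [MeasurableSpace Ω] {P : Measure Ω} {n p m : ℕ} {par : StoDARSParams n p m}
  {X : Set (Vec n)} {S : StoDARSProcess Ω n p m}

theorem norm_pollDir (hS : IsStoDARS par X P S) (k : ℕ) (j : Fin m) (ω : Ω) :
    ‖S.pollDir par.p_le_n k j ω‖ = 1 := by
  rw [StoDARSProcess.pollDir, StoDARSProcess.Uk,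
    norm_mulVec_of_transpose_mul_self (transpose_firstColumns_mul_self _ _)]
  exact hS.unit_D _ ω j

/-- An iteration is successful exactly when the incumbent changes. -/
theorem success_iff (hS : IsStoDARS par X P S) (k : ℕ) (ω : Ω) :
    S.Success par X k ω ↔ S.x (k + 1) ω ≠ S.x k ω := by
  constructor
  · intro h
    obtain ⟨j, -, hj⟩ := hS.x_success k ω h
    rw [hj, StoDARSProcess.pollPoint]
    intro hc
    have h1 : S.δ k ω • S.pollDir par.p_le_n k j ω = 0 := by simpa using hc
    have h2 := congrArg norm h1
    rw [norm_smul, hS.norm_pollDir, norm_zero, mul_one, norm_eq_zero] at h2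
    exact (hS.δ_pos k ω).ne' h2
  · intro h
    by_contra hc
    exact h (hS.x_failure k ω hc)

/-- X need not be measurable, so success is read off from the incumbent instead: poll steps have
length δ_k > 0, hence success means x_{k+1} ≠ x_k, an event of the history up to k + 1. -/
theorem measurable_δ (hS : IsStoDARS par X P S) (k : ℕ) :
    Measurable[S.history par.p_le_n k] (S.δ k) := by
  classical
  induction k with
  | zero =>
    rw [show S.δ 0 = fun _ => par.δ₀ from funext hS.δ_zero]
    exact measurable_const
  | succ k ih =>
    have hmono := S.history_mono par.p_le_n (Nat.le_succ k)
    have hset : MeasurableSet[S.history par.p_le_n (k + 1)] {ω | S.x (k + 1) ω = S.x k ω} :=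
      measurableSet_eq_fun
        (hS.adapted (k + 1)) ((hS.adapted k).mono hmono le_rfl)
    have hδ : S.δ (k + 1) = fun ω => if S.x (k + 1) ω = S.x k ω then par.τ * S.δ k ω
        else min (par.τ⁻¹ * S.δ k ω) par.δmax := by
      funext ω
      by_cases h : S.Success par X k ω
      · rw [if_neg ((hS.success_iff k ω).1 h), hS.δ_success k ω h]
      · rw [if_pos (not_not.1 ((hS.success_iff k ω).not.1 h)), hS.δ_failure k ω h]
    have ih' : Measurable[S.history par.p_le_n (k + 1)] (S.δ k) := ih.mono hmono le_rfl
    rw [hδ]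
    exact Measurable.ite hset (ih'.const_mul _) ((ih'.const_mul _).min measurable_const)

theorem measurable_pollDir (_hS : IsStoDARS par X P S) (k : ℕ) (j : Fin m) :
    Measurable[S.pollHistory par.p_le_n k] (S.pollDir par.p_le_n k j) := by
  have hpn : 0 < Real.sqrt ((n : ℝ) / p) := by
    have h1 : (0 : ℝ) < n := by exact_mod_cast (by have := par.two_le_n; omega)
    have h2 : (0 : ℝ) < p := by exact_mod_cast (by have := par.one_le_p; omega)
    positivity
  have heq : S.pollDir par.p_le_n k j = fun ω => (Real.sqrt ((n : ℝ) / p))⁻¹ •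
      (WithLp.toLp 2 ((S.Qk par.p_le_n k ω).mulVec ((S.Dk k ω).col j)) : Vec n) := by
    funext ω
    rw [StoDARSProcess.Qk, Matrix.smul_mulVec, WithLp.toLp_smul, inv_smul_smul₀ hpn.ne']
    rfl
  rw [heq]
  have h := (measurable_matrix_mul_mulVec_col j).comp
    ((S.measurable_Qk par.p_le_n k).prodMk (S.measurable_Dk par.p_le_n k))
  exact (continuous_const_smul (Real.sqrt ((n : ℝ) / p))⁻¹).measurable.comp h

theorem measurable_pollPoint (hS : IsStoDARS par X P S) (k : ℕ) (j : Fin m) :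
    Measurable[S.pollHistory par.p_le_n k] (S.pollPoint par.p_le_n k j) := by
  have h := S.history_le_pollHistory par.p_le_n k
  exact ((hS.adapted k).mono h le_rfl).add
    (((hS.measurable_δ k).mono h le_rfl).smul (hS.measurable_pollDir k j))

end IsStoDARS

/-! ### Consequences of the accuracy condition -/

section Accuracy

variable {Ω : Type*} [MeasurableSpace Ω] {P : Measure Ω} [IsProbabilityMeasure P] {n p m : ℕ}
  {par : StoDARSParams n p m} {X : Set (Vec n)} {S : StoDARSProcess Ω n p m} {f : Vec n → ℝ}
  {β : ℝ}

/-- Conditional expectation is 0 by convention when the conditioning σ-algebra is not contained in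
the ambient one, which the positive lower bound β rules out. Thus no measurability of the index t
has to be assumed. -/
theorem ProbabilisticallyAccurate.pollHistory_le (hacc : ProbabilisticallyAccurate par f β P S)
    (hβ : 0 < β) (k : ℕ) : S.pollHistory par.p_le_n k ≤ ‹MeasurableSpace Ω› := by
  by_contra h
  obtain ⟨ω, hω⟩ := (hacc k).exists
  rw [condExp_of_not_le h] at hω
  exact absurd hω (not_le.2 hβ)

theorem ProbabilisticallyAccurate.integrable_indicator
    (hacc : ProbabilisticallyAccurate par f β P S) (hβ : 0 < β) (k : ℕ) :
    Integrable ((accurateEvent par f S k).indicator fun _ => (1 : ℝ)) P := by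
  by_contra h
  obtain ⟨ω, hω⟩ := (hacc k).exists
  rw [condExp_of_not_integrable h] at hω
  exact absurd hω (not_le.2 hβ)

end Accuracy

/-! ### Small balls of the unit sphere under the Haar measure of the orthogonal group -/

instance instLocallyCompactSpaceOrthogonalGroup (n : ℕ) :
    LocallyCompactSpace (Matrix.orthogonalGroup (Fin n) ℝ) := by
  have h1 : LocallyCompactSpace (Matrix (Fin n) (Fin n) ℝ) :=
    inferInstanceAs (LocallyCompactSpace (Fin n → Fin n → ℝ))
  have h2 : IsClosed {A : Matrix (Fin n) (Fin n) ℝ | A.transpose * A = 1} :=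
    isClosed_eq (by fun_prop) continuous_const
  have h3 : IsClosed ((Matrix.orthogonalGroup (Fin n) ℝ : Submonoid _) :
      Set (Matrix (Fin n) (Fin n) ℝ)) := by
    convert h2 using 1
    ext A
    exact Matrix.mem_orthogonalGroup_iff' (Fin n) ℝ
  exact h3.isClosedEmbedding_subtypeVal.locallyCompactSpace

/-- The orthogonal group acts transitively on the unit sphere. -/
theorem exists_orthogonal_mulVec_eq {n : ℕ} {d v : Vec n} (h : ‖d‖ = ‖v‖) :
    ∃ O : Matrix.orthogonalGroup (Fin n) ℝ,
      (WithLp.toLp 2 ((O : Matrix (Fin n) (Fin n) ℝ).mulVec d.ofLp) : Vec n) = v := by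
  -- Vectors of equal norm are exchanged by the reflection in the hyperplane orthogonal to their
  -- difference (the identity if d = v).
  set r := (ℝ ∙ (d - v))ᗮ.reflection with hr
  set b := EuclideanSpace.basisFun (Fin n) ℝ with hb
  refine ⟨⟨_, r.toMatrix_mem_unitaryGroup b b⟩, ?_⟩
  have h1 := LinearMap.toMatrix_mulVec_repr b.toBasis b.toBasis
    (r.toLinearEquiv : Vec n →ₗ[ℝ] Vec n) d
  have h2 : r d = v := Submodule.reflection_sub h
  have h3 : ∀ z : Vec n, ⇑(b.toBasis.repr z) = z.ofLp := by
    intro z; ext i; simp [hb]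
  rw [h3, h3] at h1
  simp only [h1]
  exact h2

/-- The orthogonal matrices that map `d` into the `ε`-ball around `v`. -/
def mapsNear {n : ℕ} (d v : Vec n) (ε : ℝ) : Set (Matrix.orthogonalGroup (Fin n) ℝ) :=
  {A | ‖(WithLp.toLp 2 ((A : Matrix (Fin n) (Fin n) ℝ).mulVec d.ofLp) : Vec n) - v‖ < ε}

theorem isOpen_mapsNear {n : ℕ} (d v : Vec n) (ε : ℝ) : IsOpen (mapsNear d v ε) := by
  refine isOpen_lt (Continuous.norm (Continuous.sub ?_ continuous_const)) continuous_const
  exact (PiLp.continuous_toLp 2 _).comp (continuous_subtype_val.matrix_mulVec continuous_const)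

/-- If O d = v, left translation by O carries the ε-neighbourhood of 1 in operator norm into
`mapsNear d v ε`. By invariance, the positive mass of that neighbourhood serves every pair d, v. -/
theorem exists_haar_mapsNear_lower_bound {n : ℕ} (H : Measure (Matrix.orthogonalGroup (Fin n) ℝ))
    [H.IsHaarMeasure] {ε : ℝ} (hε : 0 < ε) :
    ∃ c : ENNReal, 0 < c ∧ ∀ d v : Vec n, ‖d‖ = 1 → ‖v‖ = 1 → c ≤ H (mapsNear d v ε) := by
  set T := (Matrix.toEuclideanCLM (n := Fin n) (𝕜 := ℝ)) with hT
  have hTc : Continuous fun A : Matrix.orthogonalGroup (Fin n) ℝ =>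
      ‖T ((A : Matrix (Fin n) (Fin n) ℝ) - 1)‖ := by
    have h1 : Continuous fun A : Matrix (Fin n) (Fin n) ℝ => T A :=
      LinearMap.continuous_of_finiteDimensional (T.toAlgEquiv.toLinearMap)
    exact (h1.comp (continuous_subtype_val.sub continuous_const)).norm
  have hopen := isOpen_lt hTc (continuous_const (y := ε))
  refine ⟨H _, hopen.measure_pos H ⟨1, by simpa using hε⟩, fun d v hd hv => ?_⟩
  obtain ⟨O, hO⟩ := exists_orthogonal_mulVec_eq (hd.trans hv.symm)
  rw [← measure_preimage_mul H O⁻¹ {A | ‖T ((A : Matrix (Fin n) (Fin n) ℝ) - 1)‖ < ε}]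
  refine measure_mono fun A hA => ?_
  obtain ⟨B, rfl⟩ : ∃ B, A = O * B := ⟨O⁻¹ * A, by simp⟩
  simp only [Set.mem_preimage, inv_mul_cancel_left, Set.mem_ofPred_eq] at hA
  have h1 : ‖T ((B : Matrix (Fin n) (Fin n) ℝ) - 1) d‖ < ε := by
    refine ((T _).le_opNorm d).trans_lt ?_
    rwa [hd, mul_one]
  have h2 : T ((B : Matrix (Fin n) (Fin n) ℝ) - 1) d =
      WithLp.toLp 2 ((B : Matrix (Fin n) (Fin n) ℝ).mulVec d.ofLp - d.ofLp) := by
    change WithLp.toLp 2 (((B : Matrix (Fin n) (Fin n) ℝ) - 1).mulVec d.ofLp) = _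
    rw [Matrix.sub_mulVec, Matrix.one_mulVec]
  rw [h2, ← norm_mulVec_of_transpose_mul_self ((Matrix.mem_orthogonalGroup_iff' (Fin n) ℝ).1 O.2),
    Matrix.mulVec_sub, WithLp.toLp_sub, hO, Matrix.mulVec_mulVec] at h1
  exact h1

/-! ### Density of the poll directions -/

theorem measurable_firstColumns {n p : ℕ} (hp : p ≤ n) :
    Measurable fun A : Matrix.orthogonalGroup (Fin n) ℝ =>
      firstColumns hp (A : Matrix (Fin n) (Fin n) ℝ) := by
  refine measurable_pi_lambda (X := fun _ : Fin n => Fin p → ℝ) _ fun i =>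
    measurable_pi_lambda _ fun j => ?_
  exact (measurable_matrix_apply i (Fin.castLE hp j)).comp measurable_subtype_coe

/-- Second Borel--Cantelli lemma for preimages under independent random variables. -/
theorem ae_frequently_mem_of_iIndepFun {Ω E : Type*} [MeasurableSpace Ω] [MeasurableSpace E]
    {P : Measure Ω} [IsProbabilityMeasure P] {u : ℕ → Ω → E} (hu : ∀ s, Measurable (u s))
    (hind : iIndepFun u P) {B : ℕ → Set E} (hB : ∀ s, MeasurableSet (B s)) {c : ENNReal}
    (hc : 0 < c) (hlow : ∀ s, c ≤ P (u s ⁻¹' B s)) :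
    ∀ᵐ ω ∂P, ∃ᶠ s in atTop, u s ω ∈ B s := by
  have hm : ∀ s, MeasurableSet (u s ⁻¹' B s) := fun s => hu s (hB s)
  have hset : iIndepSet (fun s => u s ⁻¹' B s) P :=
    (iIndepSet_iff_meas_biInter hm).2 fun t =>
      hind.measure_inter_preimage_eq_mul t fun i _ => hB i
  have hsum : ∑' s, P (u s ⁻¹' B s) = ⊤ := by
    refine top_unique ?_
    rw [← ENNReal.tsum_const_eq_top_of_ne_zero (α := ℕ) hc.ne']
    exact ENNReal.tsum_le_tsum hlow
  have h1 := measure_limsup_eq_one hm hset hsum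
  have h2 : MeasurableSet (limsup (fun s => u s ⁻¹' B s) atTop) :=
    MeasurableSet.measurableSet_limsup hm
  have h3 := (prob_compl_eq_zero_iff h2).2 h1
  filter_upwards [measure_eq_zero_iff_ae_notMem.1 h3] with ω hω
  rw [Set.notMem_compl_iff, mem_limsup_iff_frequently_mem] at hω
  exact hω

namespace IsStoDARS

variable {Ω : Type*} [MeasurableSpace Ω] {P : Measure Ω} {n p m : ℕ}
  {par : StoDARSParams n p m} {X : Set (Vec n)} {S : StoDARSProcess Ω n p m}

theorem measurable_block (hS : IsStoDARS par X P S) (t : ℕ) :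
    Measurable fun ω => firstColumns par.p_le_n (S.U t ω : Matrix (Fin n) (Fin n) ℝ) :=
  (measurable_firstColumns par.p_le_n).comp (hS.haar t).1

/-- Uniqueness of the Haar probability measure gives all U t the same law, so one constant serves
every t. -/
theorem exists_block_lower_bound [IsProbabilityMeasure P]
    (hS : IsStoDARS par X P S) {ε : ℝ} (hε : 0 < ε) :
    ∃ c : ENNReal, 0 < c ∧ ∀ (t : ℕ) (d : Fin p → ℝ) (v : Vec n),
      ‖(WithLp.toLp 2 d : Vec p)‖ = 1 → ‖v‖ = 1 →
      c ≤ P {ω | ‖(WithLp.toLp 2 ((firstColumns par.p_le_n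
        (S.U t ω : Matrix (Fin n) (Fin n) ℝ)).mulVec d) : Vec n) - v‖ < ε} := by
  have hH : ∀ t, (P.map (S.U t)).IsHaarMeasure := fun t => (hS.haar t).2
  have hprob : ∀ t, IsProbabilityMeasure (P.map (S.U t)) := fun t =>
    Measure.isProbabilityMeasure_map (hS.haar t).1.aemeasurable
  obtain ⟨c, hc, hlow⟩ := exists_haar_mapsNear_lower_bound (P.map (S.U 0)) hε
  refine ⟨c, hc, fun t d v hd hv => ?_⟩
  set d' : Vec n := WithLp.toLp 2 ((firstColumns par.p_le_n 1).mulVec d) with hd'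
  have hn : ‖d'‖ = 1 := by
    rw [hd', ← hd]
    exact norm_mulVec_of_transpose_mul_self
      (transpose_firstColumns_mul_self par.p_le_n (1 : Matrix.orthogonalGroup (Fin n) ℝ)) d
  have h1 := hlow d' v hn hv
  rw [Measure.isHaarMeasure_eq_of_isProbabilityMeasure (P.map (S.U 0)) (P.map (S.U t))] at h1
  rw [Measure.map_apply (hS.haar t).1 (isOpen_mapsNear d' v ε).measurableSet] at h1
  refine h1.trans (measure_mono fun ω hω => ?_)
  have h2 : ‖(WithLp.toLp 2 ((S.U t ω : Matrix (Fin n) (Fin n) ℝ).mulVec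
      ((firstColumns par.p_le_n 1).mulVec d)) : Vec n) - v‖ < ε := hω
  rwa [Matrix.mulVec_mulVec, ← firstColumns_eq_mul] at h2

/-- Almost surely, the images of a fixed column of the matrices of subspace directions come
close to a given unit vector infinitely often. -/
theorem ae_frequently_direction_near [IsProbabilityMeasure P]
    (hS : IsStoDARS par X P S)
    (j : Fin m) {v : Vec n} (hv : ‖v‖ = 1) {ε : ℝ} (hε : 0 < ε) :
    ∀ᵐ ω ∂P, ∃ᶠ s in atTop, ‖(WithLp.toLp 2 ((firstColumns par.p_le_n
      (S.U s ω : Matrix (Fin n) (Fin n) ℝ)).mulVec ((S.D s ω).col j)) : Vec n) - v‖ < ε := by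
  obtain ⟨c, hc, hlow⟩ := hS.exists_block_lower_bound hε
  have hu : Measurable fun ω t => firstColumns par.p_le_n
      (S.U t ω : Matrix (Fin n) (Fin n) ℝ) := measurable_pi_lambda _ hS.measurable_block
  have hD : Measurable fun ω t => S.D t ω := measurable_pi_lambda _ hS.measurable_D
  let q : (ℕ → Matrix (Fin p) (Fin m) ℝ) × (ℕ → Matrix (Fin n) (Fin p) ℝ) → Prop :=
    fun z => ∃ᶠ s in atTop,
      ‖(WithLp.toLp 2 ((z.2 s).mulVec ((z.1 s).col j)) : Vec n) - v‖ < ε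
  have hdir : ∀ s, Measurable fun z : (ℕ → Matrix (Fin p) (Fin m) ℝ) ×
      (ℕ → Matrix (Fin n) (Fin p) ℝ) =>
      (WithLp.toLp 2 ((z.2 s).mulVec ((z.1 s).col j)) : Vec n) := fun s =>
    (measurable_matrix_mul_mulVec_col (a := n) (b := p) (c := m) j).comp
      (f := fun z : (ℕ → Matrix (Fin p) (Fin m) ℝ) × (ℕ → Matrix (Fin n) (Fin p) ℝ) =>
        (z.2 s, z.1 s))
      (((measurable_pi_apply s).comp measurable_snd).prodMk
        ((measurable_pi_apply s).comp measurable_fst))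
  have hq : MeasurableSet {z | q z} := by
    have := MeasurableSet.measurableSet_limsup (s := fun s => {z : (ℕ → Matrix (Fin p) (Fin m) ℝ) ×
      (ℕ → Matrix (Fin n) (Fin p) ℝ) |
        ‖(WithLp.toLp 2 ((z.2 s).mulVec ((z.1 s).col j)) : Vec n) - v‖ < ε})
      fun s => measurableSet_lt ((hdir s).sub_const v).norm measurable_const
    convert this using 1
    ext z
    rw [mem_limsup_iff_frequently_mem]
    rfl
  -- The joint law is a product, so Fubini lets D be fixed; its columns are then deterministic unit
  -- vectors and only the independent blocks stay random.
  have hmap := (indepFun_iff_map_prod_eq_prod_map_map hD.aemeasurable hu.aemeasurable).1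
    hS.indep_U_D.symm
  have hprob : IsProbabilityMeasure (P.map fun ω t => firstColumns par.p_le_n
      (S.U t ω : Matrix (Fin n) (Fin n) ℝ)) := Measure.isProbabilityMeasure_map hu.aemeasurable
  suffices h : ∀ᵐ z ∂P.map (fun ω => ((fun t => S.D t ω), fun t => firstColumns par.p_le_n
      (S.U t ω : Matrix (Fin n) (Fin n) ℝ))), q z from
    (ae_map_iff (hD.prodMk hu).aemeasurable hq).1 h
  rw [hmap, Measure.ae_prod_iff_ae_ae hq]
  have hunit : MeasurableSet {D : ℕ → Matrix (Fin p) (Fin m) ℝ |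
      ∀ s, ‖(WithLp.toLp 2 ((D s).col j) : Vec p)‖ = 1} := by
    rw [Set.ofPred_forall]
    refine MeasurableSet.iInter fun s => measurableSet_eq_fun (Measurable.norm ?_) measurable_const
    refine (PiLp.continuous_toLp 2 _).measurable.comp (measurable_pi_lambda _ fun i => ?_)
    exact (measurable_matrix_apply i j).comp (measurable_pi_apply s)
  have hae : ∀ᵐ D ∂P.map (fun ω t => S.D t ω),
      ∀ s, ‖(WithLp.toLp 2 ((D s).col j) : Vec p)‖ = 1 :=
    (ae_map_iff hD.aemeasurable hunit).2 (Eventually.of_forall fun ω s => hS.unit_D s ω j)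
  filter_upwards [hae] with D hDu
  have hqD : MeasurableSet {u | q (D, u)} := measurable_prodMk_left hq
  rw [ae_map_iff hu.aemeasurable hqD]
  refine ae_frequently_mem_of_iIndepFun (B := fun s => {A : Matrix (Fin n) (Fin p) ℝ |
    ‖(WithLp.toLp 2 (A.mulVec ((D s).col j)) : Vec n) - v‖ < ε}) hS.measurable_block hS.indep_U
    (fun s => ?_) hc fun s => hlow s _ v (hDu s) hv
  refine measurableSet_lt (Measurable.norm (Measurable.sub_const ?_ v)) measurable_const
  exact (measurable_matrix_mul_mulVec_col j).comp (measurable_id.prodMk measurable_const)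

/-- A countable dense subset of the sphere and radii 1/(N + 1) bring all v and ε into one almost
sure event. -/
theorem ae_forall_frequently_direction_near [IsProbabilityMeasure P]
    (hS : IsStoDARS par X P S)
    (j : Fin m) :
    ∀ᵐ ω ∂P, ∀ v : Vec n, ‖v‖ = 1 → ∀ ε > 0, ∃ᶠ s in atTop,
      ‖(WithLp.toLp 2 ((firstColumns par.p_le_n
        (S.U s ω : Matrix (Fin n) (Fin n) ℝ)).mulVec ((S.D s ω).col j)) : Vec n) - v‖ < ε := by
  obtain ⟨T, hTc, hTd⟩ := TopologicalSpace.exists_countable_dense (Metric.sphere (0 : Vec n) 1)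
  have h : ∀ᵐ ω ∂P, ∀ v ∈ T, ∀ N : ℕ, ∃ᶠ s in atTop,
      ‖(WithLp.toLp 2 ((firstColumns par.p_le_n
        (S.U s ω : Matrix (Fin n) (Fin n) ℝ)).mulVec ((S.D s ω).col j)) : Vec n) - v.1‖ <
          1 / ((N : ℝ) + 1) := by
    rw [ae_ball_iff hTc]
    intro v _
    rw [ae_all_iff]
    intro N
    exact hS.ae_frequently_direction_near j (mem_sphere_zero_iff_norm.1 v.2) (by positivity)
  filter_upwards [h] with ω hω v hv ε hε
  obtain ⟨N, hN⟩ := exists_nat_one_div_lt (half_pos hε)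
  obtain ⟨v', hv'T, hv'⟩ := Metric.dense_iff.1 hTd ⟨v, mem_sphere_zero_iff_norm.2 hv⟩ (ε / 2)
    (half_pos hε)
  refine (hω v' hv' N).mono fun s hs => ?_
  have h1 : dist v'.1 v < ε / 2 := hv'T
  rw [← dist_eq_norm] at hs ⊢
  linarith [dist_triangle (WithLp.toLp 2 ((firstColumns par.p_le_n
        (S.U s ω : Matrix (Fin n) (Fin n) ℝ)).mulVec ((S.D s ω).col j)) : Vec n) v'.1 v]

end IsStoDARS

/-! ### Auxiliary facts on integration -/

theorem integral_mul_condExp_of_bound {Ω : Type*} {m m₀ : MeasurableSpace Ω} {P : Measure Ω}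
    [IsFiniteMeasure P] (hm : m ≤ m₀) {w g : Ω → ℝ} (hw : Measurable[m] w) {C : ℝ}
    (hwC : ∀ ω, |w ω| ≤ C) (hg : Integrable g P) :
    Integrable (fun ω => w ω * g ω) P ∧ Integrable (fun ω => w ω * (P[g | m]) ω) P ∧
      ∫ ω, w ω * g ω ∂P = ∫ ω, w ω * (P[g | m]) ω ∂P := by
  have hw' : AEStronglyMeasurable w P := (hw.mono hm le_rfl).aestronglyMeasurable
  have hb : ∀ᵐ ω ∂P, ‖w ω‖ ≤ C := Eventually.of_forall hwC
  refine ⟨hg.bdd_mul hw' hb, integrable_condExp.bdd_mul hw' hb, ?_⟩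
  have h := condExp_stronglyMeasurable_mul_of_bound hm hw.stronglyMeasurable hg C hb
  have h1 := integral_condExp (μ := P) hm (f := w * g)
  rw [integral_congr_ae h] at h1
  exact h1.symm

/-- By monotone convergence the series has finite mean, so it converges almost surely and its terms
vanish. -/
theorem ae_tendsto_zero_of_sum_integral_le {Ω : Type*} [MeasurableSpace Ω] {P : Measure Ω}
    {g : ℕ → Ω → ℝ} (hg : ∀ k, Integrable (g k) P) (hnn : ∀ k ω, 0 ≤ g k ω) {C : ℝ}
    (hC : ∀ N, ∑ k ∈ Finset.range N, ∫ ω, g k ω ∂P ≤ C) :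
    ∀ᵐ ω ∂P, Tendsto (fun k => g k ω) atTop (𝓝 0) := by
  have hsum : Summable fun k => ∫ ω, g k ω ∂P :=
    summable_of_sum_range_le (fun k => integral_nonneg (hnn k)) hC
  have h1 : ∫⁻ ω, ∑' k, ENNReal.ofReal (g k ω) ∂P ≠ ⊤ := by
    rw [lintegral_tsum fun k => (hg k).aestronglyMeasurable.aemeasurable.ennreal_ofReal]
    simp_rw [← fun k => ofReal_integral_eq_lintegral_ofReal (hg k)
      (Eventually.of_forall (hnn k))]
    exact hsum.tsum_ofReal_ne_top
  have h2 : AEMeasurable (fun ω => ∑' k, ENNReal.ofReal (g k ω)) P :=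
    AEMeasurable.tsum fun k => (hg k).aestronglyMeasurable.aemeasurable.ennreal_ofReal
  filter_upwards [ae_lt_top' h2 h1] with ω hω
  have h3 := ENNReal.tendsto_atTop_zero_of_tsum_ne_top hω.ne
  have h4 := (ENNReal.tendsto_toReal ENNReal.zero_ne_top).comp h3
  simpa [Function.comp_def, ENNReal.toReal_ofReal (hnn _ _)] using h4

/-- A measurable choice of an index among finitely many measurable events. -/
theorem exists_measurable_index {Ω : Type*} [MeasurableSpace Ω] {m : ℕ} (hm : 0 < m)
    {T : Fin m → Set Ω} (hT : ∀ j, MeasurableSet (T j)) :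
    ∃ J : Ω → Fin m, Measurable J ∧ ∀ ω, (∃ j, ω ∈ T j) → ω ∈ T (J ω) := by
  classical
  -- Vacuously true at N = m, so that the least index always exists.
  let q : Ω → ℕ → Prop := fun ω N => ∀ h : N < m, ω ∈ T ⟨N, h⟩
  have hq : ∀ ω, ∃ N, q ω N := fun ω => ⟨m, fun h => absurd h (lt_irrefl m)⟩
  have hqm : ∀ N, MeasurableSet {ω | q ω N} := by
    intro N
    by_cases h : N < m
    · simpa [q, h] using hT ⟨N, h⟩
    · simp [q, h]
  refine ⟨fun ω => if h : Nat.find (hq ω) < m then ⟨Nat.find (hq ω), h⟩ else ⟨0, hm⟩, ?_, ?_⟩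
  · exact (measurable_from_top (f := fun N => if h : N < m then (⟨N, h⟩ : Fin m) else ⟨0, hm⟩)).comp
      (measurable_find hq hqm)
  · rintro ω ⟨j, hj⟩
    have h1 : Nat.find (hq ω) ≤ j := Nat.find_min' _ fun _ => hj
    have h2 : Nat.find (hq ω) < m := h1.trans_lt j.2
    simp only [h2, dif_pos]
    exact Nat.find_spec (hq ω) h2

/-! ### Descent of the merit function -/

/-- Change of the merit function over one iteration. `I` is the indicator of accuracy, `e₀` and
`e₁` are the errors at the incumbent and at the new point. -/
theorem merit_change_le {ε γ τ ν : ℝ} (hε : 0 < ε) (hγ : 2 < γ) (hτ : 0 < τ) (hτ1 : τ < 1)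
    (hν0 : 0 < ν) (hν1 : ν < 1) (hντ : 2 * ((τ ^ 2)⁻¹ - 1) / (γ - 2) ≤ ν / (1 - ν))
    {δ δ' φ φ' e₀ e₁ I : ℝ} (hδ : 0 < δ) (hδ' : 0 < δ')
    (hI : I = 0 ∨ I = 1 ∧ e₀ ≤ ε * δ ^ 2 ∧ e₁ ≤ ε * δ ^ 2)
    (h : φ' = φ ∧ δ' = τ * δ ∨ φ' - φ ≤ -γ * ε * δ ^ 2 + e₀ + e₁ ∧ δ' ≤ τ⁻¹ * δ) (hI1 : I ≤ 1) :
    ν / ε * (φ' - φ) + (1 - ν) * (δ' ^ 2 - δ ^ 2) ≤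
      -((1 - ν) * (1 - τ ^ 2)) * δ ^ 2 +
        ν / (2 * ε ^ 2) * ((δ ^ 2)⁻¹ * e₀ ^ 2 + (δ ^ 2)⁻¹ * e₁ ^ 2) +
          ν * (δ ^ 2 - δ ^ 2 * I) := by
  have hsq : 0 ≤ ν / (2 * ε ^ 2) * ((δ ^ 2)⁻¹ * e₀ ^ 2 + (δ ^ 2)⁻¹ * e₁ ^ 2) := by positivity
  have hδ2 : 0 < δ ^ 2 := by positivity
  have hrest : 0 ≤ ν * (δ ^ 2 - δ ^ 2 * I) := mul_nonneg hν0.le (by nlinarith)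
  have hτ2 : 0 < τ ^ 2 := by positivity
  have hτ21 : τ ^ 2 < 1 := by nlinarith
  rcases h with ⟨rfl, rfl⟩ | ⟨hφ, hstep⟩
  · have : ν / ε * (φ' - φ') + (1 - ν) * ((τ * δ) ^ 2 - δ ^ 2) =
      -((1 - ν) * (1 - τ ^ 2)) * δ ^ 2 := by ring
    linarith
  -- Half of ν(γ − 2)δ² pays for the growth of the stepsize; by τ⁻² − 1 ≥ 1 − τ², the other half
  -- leaves the same decrease as a failure.
  · have hc1 : (1 - ν) * ((τ ^ 2)⁻¹ - 1) ≤ ν * (γ - 2) / 2 := by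
      rw [div_le_div_iff₀ (by linarith) (by linarith)] at hντ
      linarith
    have hc2 : 1 - τ ^ 2 ≤ (τ ^ 2)⁻¹ - 1 := by
      have h1 : τ ^ 2 * (τ ^ 2)⁻¹ = 1 := mul_inv_cancel₀ hτ2.ne'
      have h2 : 1 ≤ (τ ^ 2)⁻¹ := (one_le_inv₀ hτ2).2 hτ21.le
      nlinarith
    have hc3 := mul_le_mul_of_nonneg_left hc2 (sub_nonneg.2 hν1.le)
    have hd : δ' ^ 2 ≤ (τ ^ 2)⁻¹ * δ ^ 2 := by
      rw [← inv_pow, ← mul_pow]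
      exact pow_le_pow_left₀ hδ'.le hstep 2
    have hd' : (1 - ν) * (δ' ^ 2 - δ ^ 2) ≤ (1 - ν) * ((τ ^ 2)⁻¹ - 1) * δ ^ 2 := by
      rw [mul_assoc]
      exact mul_le_mul_of_nonneg_left (by linarith) (sub_nonneg.2 hν1.le)
    have hφ' : ν / ε * (φ' - φ) ≤ -ν * γ * δ ^ 2 + ν * (e₀ / ε + e₁ / ε) := by
      refine (mul_le_mul_of_nonneg_left hφ (by positivity)).trans_eq ?_
      field_simp
      ring
    have hm1 := mul_le_mul_of_nonneg_right hc1 hδ2.le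
    have hm3 := mul_le_mul_of_nonneg_right hc3 hδ2.le
    rcases hI with rfl | ⟨-, h0, h1⟩
    -- Young's inequality: each inaccurate error costs its scaled square plus νδ²/2, and the two
    -- halves make up the term ν(δ² − δ²I) with I = 0.
    · have key : ∀ e : ℝ, ν * (e / ε) ≤
          ν / (2 * ε ^ 2) * ((δ ^ 2)⁻¹ * e ^ 2) + ν * δ ^ 2 / 2 := by
        intro e
        have h3 : ν / (2 * ε ^ 2) * ((δ ^ 2)⁻¹ * e ^ 2) + ν * δ ^ 2 / 2 - ν * (e / ε) =
            ν / 2 * (e / (ε * δ) - δ) ^ 2 := by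
          field_simp
          ring
        have h4 : 0 ≤ ν / 2 * (e / (ε * δ) - δ) ^ 2 := by positivity
        linarith
      have k0 := key e₀
      have k1 := key e₁
      have hγ' : 0 ≤ ν * (γ - 2) * δ ^ 2 := by
        have : 0 < γ - 2 := by linarith
        positivity
      nlinarith [mul_pos hν0 hδ2]
    · have h0' : e₀ / ε ≤ δ ^ 2 := by rw [div_le_iff₀ hε]; linarith
      have h1' : e₁ / ε ≤ δ ^ 2 := by rw [div_le_iff₀ hε]; linarith
      have hs : ν * (e₀ / ε + e₁ / ε) ≤ ν * (2 * δ ^ 2) :=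
        mul_le_mul_of_nonneg_left (by linarith) hν0.le
      nlinarith

/-! ### Summability of the squared stepsizes and errors -/

namespace IsStoDARS

variable {Ω : Type*} [MeasurableSpace Ω] {P : Measure Ω} {n p m : ℕ}
  {par : StoDARSParams n p m} {X : Set (Vec n)} {S : StoDARSProcess Ω n p m}

theorem abs_δ_sq_le (hS : IsStoDARS par X P S) (k : ℕ) (ω : Ω) :
    |S.δ k ω ^ 2| ≤ par.δmax ^ 2 := by
  rw [abs_of_nonneg (sq_nonneg _)]
  exact pow_le_pow_left₀ (hS.δ_pos k ω).le (hS.δ_bounds k ω).2 2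

theorem abs_inv_δ_sq_le (hS : IsStoDARS par X P S) (k : ℕ) (ω : Ω) :
    |(S.δ k ω ^ 2)⁻¹| ≤ ((par.τ ^ k * par.δ₀) ^ 2)⁻¹ := by
  have hpos : 0 < par.τ ^ k * par.δ₀ := mul_pos (pow_pos par.τ_pos k) par.δ₀_pos
  rw [abs_of_nonneg (inv_nonneg.2 (sq_nonneg _))]
  exact inv_anti₀ (by positivity) (pow_le_pow_left₀ hpos.le (hS.δ_bounds k ω).1 2)

theorem integrable_δ_sq [IsProbabilityMeasure P]
    (hS : IsStoDARS par X P S) {k : ℕ}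
    (hm : S.pollHistory par.p_le_n k ≤ ‹MeasurableSpace Ω›) :
    Integrable (fun ω => S.δ k ω ^ 2) P := by
  refine Integrable.of_bound (C := par.δmax ^ 2) ?_
    (Eventually.of_forall fun ω => hS.abs_δ_sq_le k ω)
  exact ((hS.measurable_δ k).mono ((S.history_le_pollHistory _ k).trans hm) le_rfl
    |>.pow_const 2).aestronglyMeasurable

/-- Mean of a squared error relative to the squared stepsize. -/
theorem integral_scaled_error_le [IsProbabilityMeasure P]
    (hS : IsStoDARS par X P S) {k : ℕ}
    (hm : S.pollHistory par.p_le_n k ≤ ‹MeasurableSpace Ω›) {g : Ω → ℝ} (hg : Integrable g P)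
    {c : ℝ} (hgc : ∀ᵐ ω ∂P, (P[g | S.pollHistory par.p_le_n k]) ω ≤ c * S.δ k ω ^ 4) :
    Integrable (fun ω => (S.δ k ω ^ 2)⁻¹ * g ω) P ∧
      ∫ ω, (S.δ k ω ^ 2)⁻¹ * g ω ∂P ≤ c * ∫ ω, S.δ k ω ^ 2 ∂P := by
  have hw : Measurable[S.pollHistory par.p_le_n k] fun ω => (S.δ k ω ^ 2)⁻¹ :=
    (((hS.measurable_δ k).mono (S.history_le_pollHistory _ k) le_rfl).pow_const 2).inv
  obtain ⟨h1, h2, h3⟩ := integral_mul_condExp_of_bound hm hw (hS.abs_inv_δ_sq_le k) hg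
  refine ⟨h1, ?_⟩
  rw [h3, ← integral_const_mul]
  refine integral_mono_ae h2 ((hS.integrable_δ_sq hm).const_mul c) ?_
  filter_upwards [hgc] with ω hω
  have hδ := hS.δ_pos k ω
  refine (mul_le_mul_of_nonneg_left hω (by positivity)).trans_eq ?_
  field_simp

/-- The mean squared stepsize over the accurate event. -/
theorem integral_δ_sq_accurate_ge [IsProbabilityMeasure P]
    (hS : IsStoDARS par X P S) {f : Vec n → ℝ} {β : ℝ} (hβ : 0 < β)
    (hacc : ProbabilisticallyAccurate par f β P S) (k : ℕ) :
    Integrable (fun ω => S.δ k ω ^ 2 *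
        (accurateEvent par f S k).indicator (fun _ => (1 : ℝ)) ω) P ∧
      β * ∫ ω, S.δ k ω ^ 2 ∂P ≤ ∫ ω, S.δ k ω ^ 2 *
        (accurateEvent par f S k).indicator (fun _ => (1 : ℝ)) ω ∂P := by
  have hm := hacc.pollHistory_le hβ k
  have hw : Measurable[S.pollHistory par.p_le_n k] fun ω => S.δ k ω ^ 2 :=
    ((hS.measurable_δ k).mono (S.history_le_pollHistory _ k) le_rfl).pow_const 2
  obtain ⟨h1, h2, h3⟩ := integral_mul_condExp_of_bound hm hw (hS.abs_δ_sq_le k)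
    (hacc.integrable_indicator hβ k)
  refine ⟨h1, ?_⟩
  rw [h3, ← integral_const_mul]
  refine integral_mono_ae ((hS.integrable_δ_sq hm).const_mul β) h2 ?_
  filter_upwards [hacc k] with ω hω
  rw [mul_comm]
  exact mul_le_mul_of_nonneg_left hω (sq_nonneg _)

/-- At a successful iteration the new incumbent is the trial point with a measurable index. -/
theorem exists_measurable_step (hS : IsStoDARS par X P S) {k : ℕ}
    (hm : S.pollHistory par.p_le_n k ≤ ‹MeasurableSpace Ω›)
    (hm' : S.pollHistory par.p_le_n (k + 1) ≤ ‹MeasurableSpace Ω›) :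
    ∃ J : Ω → Fin m, Measurable J ∧ ∀ ω, S.Success par X k ω →
      S.x (k + 1) ω = S.pollPoint par.p_le_n k (J ω) ω ∧
        S.est k (J ω) ω - S.est₀ k ω ≤ -par.γ * par.εf * S.δ k ω ^ 2 := by
  have hh := (S.history_le_pollHistory par.p_le_n k).trans hm
  have hh' := (S.history_le_pollHistory par.p_le_n (k + 1)).trans hm'
  have hmpos : 0 < m := by have := par.p_lt_m; omega
  obtain ⟨J, hJ, hJT⟩ := exists_measurable_index hmpos
    -- Feasibility is left out, X being possibly nonmeasurable; equality with the new incumbent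
    -- replaces it.
    (T := fun j => {ω | S.x (k + 1) ω = S.pollPoint par.p_le_n k j ω} ∩
      {ω | S.est k j ω - S.est₀ k ω ≤ -par.γ * par.εf * S.δ k ω ^ 2}) fun j =>
    (measurableSet_eq_fun ((hS.adapted (k + 1)).mono hh' le_rfl)
      ((hS.measurable_pollPoint k j).mono hm le_rfl)).inter
    (measurableSet_le ((hS.measurable_est k j).sub (hS.measurable_est₀ k))
      ((((hS.measurable_δ k).mono hh le_rfl).pow_const 2).const_mul _))
  refine ⟨J, hJ, fun ω hω => hJT ω ?_⟩
  obtain ⟨j, hj, hx⟩ := hS.x_success k ω hω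
  exact ⟨j, hx, hj.2⟩

/-- The merit function of the convergence analysis. -/
def merit (par : StoDARSParams n p m) (S : StoDARSProcess Ω n p m) (f : Vec n → ℝ) (b ν : ℝ)
    (k : ℕ) (ω : Ω) : ℝ :=
  ν / par.εf * (f (S.x k ω) - b) + (1 - ν) * S.δ k ω ^ 2

variable {f : Vec n → ℝ} {ν β b : ℝ}

/-- In mean, inaccuracy and squared errors each cost at most ν(1 − β)E δ_k². Their sum is at most
half of the pathwise decrease aE δ_k², where a = (1 − ν)(1 − τ²). -/
theorem integral_merit_succ_le [IsProbabilityMeasure P]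
    (hS : IsStoDARS par X P S) (hf : Continuous f)
    (hb : ∀ y, b ≤ f y) (hν : ν ∈ Set.Ioo (0 : ℝ) 1) (hβ : β ∈ Set.Ioo (0 : ℝ) 1)
    (hντ : 2 * ((par.τ ^ 2)⁻¹ - 1) / (par.γ - 2) ≤ ν / (1 - ν))
    (hβν : 4 * ν / ((1 - ν) * (1 - par.τ ^ 2)) ≤ β / (1 - β))
    (hacc : ProbabilisticallyAccurate par f β P S)
    (hvar : VarianceCondition par f β P S) {k : ℕ} (hk : Integrable (merit par S f b ν k) P) :
    Integrable (merit par S f b ν (k + 1)) P ∧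
      ∫ ω, merit par S f b ν (k + 1) ω ∂P + (1 - ν) * (1 - par.τ ^ 2) / 2 * ∫ ω, S.δ k ω ^ 2 ∂P ≤
        ∫ ω, merit par S f b ν k ω ∂P := by
  obtain ⟨hν0, hν1⟩ := hν
  obtain ⟨hβ0, hβ1⟩ := hβ
  have hε := par.εf_pos
  have hτ := par.τ_pos
  have hτ1 := par.τ_lt_one
  have hm := hacc.pollHistory_le hβ0 k
  have hm' := hacc.pollHistory_le hβ0 (k + 1)
  have hh' := (S.history_le_pollHistory par.p_le_n (k + 1)).trans hm'
  obtain ⟨J, hJ, hJs⟩ := hS.exists_measurable_step hm hm'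
  obtain ⟨i0, b0⟩ := hS.integral_scaled_error_le hm (hvar k).1.1 (hvar k).1.2
  obtain ⟨i1, b1⟩ := hS.integral_scaled_error_le hm ((hvar k).2 J hJ).1 ((hvar k).2 J hJ).2
  obtain ⟨iA, bA⟩ := hS.integral_δ_sq_accurate_ge hβ0 hacc k
  have iδ := hS.integrable_δ_sq hm
  set e₀ : Ω → ℝ := fun ω => |S.est₀ k ω - f (S.x k ω)| with he₀
  set e₁ : Ω → ℝ := fun ω => |S.est k (J ω) ω - f (S.pollPoint par.p_le_n k (J ω) ω)| with he₁
  set I : Ω → ℝ := (accurateEvent par f S k).indicator (fun _ => (1 : ℝ)) with hI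
  set a := (1 - ν) * (1 - par.τ ^ 2) with ha
  set R : Ω → ℝ := fun ω => merit par S f b ν k ω + (-a * S.δ k ω ^ 2 +
    ν / (2 * par.εf ^ 2) * ((S.δ k ω ^ 2)⁻¹ * e₀ ω ^ 2 + (S.δ k ω ^ 2)⁻¹ * e₁ ω ^ 2) +
      ν * (S.δ k ω ^ 2 - S.δ k ω ^ 2 * I ω)) with hR
  have hle : ∀ ω, merit par S f b ν (k + 1) ω ≤ R ω := by
    intro ω
    have key := merit_change_le (I := I ω) (e₀ := e₀ ω) (e₁ := e₁ ω) (φ := f (S.x k ω))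
      (φ' := f (S.x (k + 1) ω)) hε par.two_lt_γ hτ hτ1 hν0 hν1 hντ (hS.δ_pos k ω)
      (hS.δ_pos (k + 1) ω) ?_ ?_ ?_
    · simp only [hR, merit]
      linarith
    · by_cases hω : ω ∈ accurateEvent par f S k
      · exact Or.inr ⟨by simp [hI, hω], hω.1, hω.2 (J ω)⟩
      · exact Or.inl (by simp [hI, hω])
    · by_cases h : S.Success par X k ω
      · refine Or.inr ⟨?_, ?_⟩
        · obtain ⟨hx, hest⟩ := hJs ω h
          rw [hx]
          have h0 := le_abs_self (S.est₀ k ω - f (S.x k ω))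
          have h1 := neg_abs_le (S.est k (J ω) ω - f (S.pollPoint par.p_le_n k (J ω) ω))
          simp only [he₀, he₁]
          linarith
        · rw [hS.δ_success k ω h]
          exact min_le_left _ _
      · exact Or.inl ⟨by rw [hS.x_failure k ω h], hS.δ_failure k ω h⟩
    · simp only [hI]
      exact Set.indicator_le_self' (fun _ _ => zero_le_one) ω
  have iR1 : Integrable (fun ω => (S.δ k ω ^ 2)⁻¹ * e₀ ω ^ 2 + (S.δ k ω ^ 2)⁻¹ * e₁ ω ^ 2) P :=
    i0.add i1
  have iR2 : Integrable (fun ω => S.δ k ω ^ 2 - S.δ k ω ^ 2 * I ω) P := iδ.sub iA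
  have j1 : Integrable (fun ω => -a * S.δ k ω ^ 2) P := iδ.const_mul _
  have j2 := iR1.const_mul (ν / (2 * par.εf ^ 2))
  have j3 := iR2.const_mul ν
  have j12 : Integrable (fun ω => -a * S.δ k ω ^ 2 +
      ν / (2 * par.εf ^ 2) * ((S.δ k ω ^ 2)⁻¹ * e₀ ω ^ 2 + (S.δ k ω ^ 2)⁻¹ * e₁ ω ^ 2)) P :=
    j1.add j2
  have j123 : Integrable (fun ω => -a * S.δ k ω ^ 2 +
      ν / (2 * par.εf ^ 2) * ((S.δ k ω ^ 2)⁻¹ * e₀ ω ^ 2 + (S.δ k ω ^ 2)⁻¹ * e₁ ω ^ 2) +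
        ν * (S.δ k ω ^ 2 - S.δ k ω ^ 2 * I ω)) P := j12.add j3
  have iR : Integrable R P := hk.add j123
  have hnn : ∀ ω, 0 ≤ merit par S f b ν (k + 1) ω := by
    intro ω
    have h1 := sub_nonneg.2 (hb (S.x (k + 1) ω))
    have h2 := sub_nonneg.2 hν1.le
    unfold merit
    positivity
  have hmeas : Measurable (merit par S f b ν (k + 1)) := by
    have h1 : Measurable (S.x (k + 1)) := (hS.adapted (k + 1)).mono hh' le_rfl
    have h2 : Measurable (S.δ (k + 1)) := (hS.measurable_δ (k + 1)).mono hh' le_rfl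
    exact (((hf.measurable.comp h1).sub_const b).const_mul _).add ((h2.pow_const 2).const_mul _)
  have iM : Integrable (merit par S f b ν (k + 1)) P :=
    iR.mono' hmeas.aestronglyMeasurable (Eventually.of_forall fun ω => by
      rw [Real.norm_of_nonneg (hnn ω)]; exact hle ω)
  refine ⟨iM, ?_⟩
  have hint : ∫ ω, R ω ∂P = ∫ ω, merit par S f b ν k ω ∂P + (-a * ∫ ω, S.δ k ω ^ 2 ∂P +
      ν / (2 * par.εf ^ 2) * (∫ ω, (S.δ k ω ^ 2)⁻¹ * e₀ ω ^ 2 ∂P +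
        ∫ ω, (S.δ k ω ^ 2)⁻¹ * e₁ ω ^ 2 ∂P) +
      ν * (∫ ω, S.δ k ω ^ 2 ∂P - ∫ ω, S.δ k ω ^ 2 * I ω ∂P)) := by
    simp only [hR]
    rw [integral_add hk j123, integral_add j12 j3, integral_add j1 j2, integral_const_mul,
      integral_const_mul, integral_const_mul, integral_add i0 i1, integral_sub iδ iA]
  have hmono := integral_mono iM iR hle
  rw [hint] at hmono
  set D := ∫ ω, S.δ k ω ^ 2 ∂P with hD
  have hD0 : 0 ≤ D := integral_nonneg fun ω => sq_nonneg _
  have hτ21 : par.τ ^ 2 < 1 := by nlinarith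
  have ha0 : 0 < a := mul_pos (by linarith) (by linarith)
  -- From 4ν(1 − β) ≤ βa ≤ a.
  have hβa : 2 * ν * (1 - β) ≤ a / 2 := by
    rw [div_le_div_iff₀ ha0 (by linarith)] at hβν
    nlinarith
  have hE : ν / (2 * par.εf ^ 2) * (∫ ω, (S.δ k ω ^ 2)⁻¹ * e₀ ω ^ 2 ∂P +
      ∫ ω, (S.δ k ω ^ 2)⁻¹ * e₁ ω ^ 2 ∂P) ≤ ν * (1 - β) * D := by
    refine (mul_le_mul_of_nonneg_left (add_le_add b0 b1) (by positivity)).trans_eq ?_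
    field_simp
    ring
  have hA : ν * (D - ∫ ω, S.δ k ω ^ 2 * I ω ∂P) ≤ ν * ((1 - β) * D) :=
    mul_le_mul_of_nonneg_left (by linarith) hν0.le
  have hfin := mul_le_mul_of_nonneg_right hβa hD0
  linarith

/-- The expected decrease telescopes against a nonnegative merit function with deterministic initial
value. -/
theorem exists_sum_integral_δ_sq_le [IsProbabilityMeasure P]
    (hS : IsStoDARS par X P S) (hf : Continuous f)
    (hf_bdd : BddBelow (Set.range f)) (hν : ν ∈ Set.Ioo (0 : ℝ) 1) (hβ : β ∈ Set.Ioo (0 : ℝ) 1)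
    (hντ : 2 * ((par.τ ^ 2)⁻¹ - 1) / (par.γ - 2) ≤ ν / (1 - ν))
    (hβν : 4 * ν / ((1 - ν) * (1 - par.τ ^ 2)) ≤ β / (1 - β))
    (hacc : ProbabilisticallyAccurate par f β P S)
    (hvar : VarianceCondition par f β P S) :
    ∃ C : ℝ, ∀ N, ∑ k ∈ Finset.range N, ∫ ω, S.δ k ω ^ 2 ∂P ≤ C := by
  obtain ⟨b, hb⟩ := hf_bdd
  have hb' : ∀ y, b ≤ f y := fun y => hb ⟨y, rfl⟩
  obtain ⟨x₀, -, hx₀⟩ := hS.x_zero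
  have h0 : merit par S f b ν 0 =
      fun _ => ν / par.εf * (f x₀ - b) + (1 - ν) * par.δ₀ ^ 2 := by
    funext ω
    rw [merit, hx₀, hS.δ_zero]
  have hint : ∀ k, Integrable (merit par S f b ν k) P := by
    intro k
    induction k with
    | zero => rw [h0]; exact integrable_const _
    | succ k ih => exact (hS.integral_merit_succ_le hf hb' hν hβ hντ hβν hacc hvar ih).1
  have hτ2 : par.τ ^ 2 < 1 := by nlinarith [par.τ_pos, par.τ_lt_one]
  set c := (1 - ν) * (1 - par.τ ^ 2) / 2 with hc
  have hc0 : 0 < c := half_pos (mul_pos (by linarith [hν.2]) (by linarith))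
  have hsum : ∀ N, ∫ ω, merit par S f b ν N ω ∂P +
      c * ∑ k ∈ Finset.range N, ∫ ω, S.δ k ω ^ 2 ∂P ≤ ∫ ω, merit par S f b ν 0 ω ∂P := by
    intro N
    induction N with
    | zero => simp
    | succ N ih =>
      have := (hS.integral_merit_succ_le hf hb' hν hβ hντ hβν hacc hvar (hint N)).2
      rw [← hc] at this
      rw [Finset.sum_range_succ, mul_add]
      linarith
  refine ⟨(∫ ω, merit par S f b ν 0 ω ∂P) / c, fun N => ?_⟩
  rw [le_div_iff₀ hc0]
  have hN : 0 ≤ ∫ ω, merit par S f b ν N ω ∂P := integral_nonneg fun ω => by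
    have h1 := sub_nonneg.2 (hb' (S.x N ω))
    have h2 := sub_nonneg.2 hν.2.le
    have h3 := hν.1
    have h4 := par.εf_pos
    simp only [merit, Pi.zero_apply]
    positivity
  linarith [hsum N]

/-- Stepsizes tend to zero almost surely, and so do the estimation errors divided by them. -/
theorem ae_tendsto_zero [IsProbabilityMeasure P]
    (hS : IsStoDARS par X P S) (hβ : 0 < β)
    (hacc : ProbabilisticallyAccurate par f β P S) (hvar : VarianceCondition par f β P S)
    (hsum : ∃ C : ℝ, ∀ N, ∑ k ∈ Finset.range N, ∫ ω, S.δ k ω ^ 2 ∂P ≤ C) (hβ1 : β < 1) :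
    ∀ᵐ ω ∂P, Tendsto (fun k => S.δ k ω) atTop (𝓝 0) ∧
      Tendsto (fun k => |S.est₀ k ω - f (S.x k ω)| / S.δ k ω) atTop (𝓝 0) ∧
      ∀ j, Tendsto (fun k => |S.est k j ω - f (S.pollPoint par.p_le_n k j ω)| / S.δ k ω)
        atTop (𝓝 0) := by
  obtain ⟨C, hC⟩ := hsum
  have hsqrt : ∀ {u : ℕ → ℝ}, (∀ k, 0 ≤ u k) → Tendsto (fun k => u k ^ 2) atTop (𝓝 0) →
      Tendsto u atTop (𝓝 0) := by
    intro u hu h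
    have h1 := h.sqrt
    simpa [Real.sqrt_sq (hu _)] using h1
  have hδ := ae_tendsto_zero_of_sum_integral_le
    (fun k => hS.integrable_δ_sq (hacc.pollHistory_le hβ k)) (fun k ω => sq_nonneg _) hC
  have herr : ∀ g : ℕ → Ω → ℝ, (∀ k, Integrable (fun ω => |g k ω| ^ 2) P) →
      (∀ k, ∀ᵐ ω ∂P, (P[fun ω => |g k ω| ^ 2 | S.pollHistory par.p_le_n k]) ω ≤
        par.εf ^ 2 * (1 - β) * S.δ k ω ^ 4) →
      ∀ᵐ ω ∂P, Tendsto (fun k => |g k ω| / S.δ k ω) atTop (𝓝 0) := by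
    intro g hg hgc
    have hs := fun k => hS.integral_scaled_error_le (hacc.pollHistory_le hβ k) (hg k) (hgc k)
    have hc : 0 ≤ par.εf ^ 2 * (1 - β) := mul_nonneg (sq_nonneg _) (by linarith)
    have h1 := ae_tendsto_zero_of_sum_integral_le (fun k => (hs k).1)
      (fun k ω => mul_nonneg (inv_nonneg.2 (sq_nonneg _)) (sq_nonneg _))
      (C := par.εf ^ 2 * (1 - β) * C) fun N => by
        refine (Finset.sum_le_sum fun k _ => (hs k).2).trans ?_
        rw [← Finset.mul_sum]
        exact mul_le_mul_of_nonneg_left (hC N) hc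
    filter_upwards [h1] with ω hω
    refine hsqrt (fun k => div_nonneg (abs_nonneg _) (hS.δ_pos k ω).le) ?_
    refine hω.congr fun k => ?_
    rw [div_pow, div_eq_inv_mul]
  have h0 := herr (fun k ω => S.est₀ k ω - f (S.x k ω)) (fun k => (hvar k).1.1)
    fun k => (hvar k).1.2
  have hj : ∀ᵐ ω ∂P, ∀ j, Tendsto (fun k =>
      |S.est k j ω - f (S.pollPoint par.p_le_n k j ω)| / S.δ k ω) atTop (𝓝 0) := by
    rw [ae_all_iff]
    intro j
    exact herr (fun k ω => S.est k j ω - f (S.pollPoint par.p_le_n k j ω))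
      (fun k => ((hvar k).2 (fun _ => j) measurable_const).1)
      fun k => ((hvar k).2 (fun _ => j) measurable_const).2
  filter_upwards [hδ, h0, hj] with ω h1 h2 h3
  exact ⟨hsqrt (fun k => (hS.δ_pos k ω).le) h1, h2, h3⟩

end IsStoDARS

/-! ### Stationarity of refined points -/

theorem neBot_alongSet {K : Set ℕ} (hK : K.Infinite) : (alongSet K).NeBot := by
  rw [alongSet, ← frequently_mem_iff_neBot]
  exact Nat.frequently_atTop_iff_infinite.2 hK

/-- If the matrix indices used in `K` exhaust the naturals up to finitely many, a property of
the matrices that holds for infinitely many indices holds for infinitely many iterations in `K`. -/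
theorem frequently_alongSet_of_frequently {K : Set ℕ} {t : ℕ → ℕ}
    (hK : {s : ℕ | ∀ k ∈ K, t k ≠ s}.Finite) {q : ℕ → Prop} (hq : ∃ᶠ s in atTop, q s) :
    ∃ᶠ k in alongSet K, q (t k) := by
  rw [alongSet, frequently_inf_principal, Nat.frequently_atTop_iff_infinite]
  rw [Nat.frequently_atTop_iff_infinite] at hq
  -- The map t sends the wanted iterations onto infinitely many indices, so there are infinitely
  -- many of them.
  refine Set.Infinite.of_image t ((hq.sdiff hK).mono ?_)
  rintro s ⟨hs, hs'⟩
  simp only [Set.mem_ofPred_eq, not_forall, not_not] at hs'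
  obtain ⟨k, hk, rfl⟩ := hs'
  exact ⟨k, ⟨hk, hs⟩, rfl⟩

namespace IsStoDARS

variable {Ω : Type*} {n p m : ℕ}
  {par : StoDARSParams n p m} {X : Set (Vec n)} {S : StoDARSProcess Ω n p m} {f : Vec n → ℝ}

/-- Lower bound on the difference quotients at unsuccessful iterations. -/
def quotientBound (par : StoDARSParams n p m) (S : StoDARSProcess Ω n p m) (f : Vec n → ℝ)
    (ω : Ω) (k : ℕ) : ℝ :=
  -par.γ * par.εf * S.δ k ω - |S.est₀ k ω - f (S.x k ω)| / S.δ k ω -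
    ∑ j, |S.est k j ω - f (S.pollPoint par.p_le_n k j ω)| / S.δ k ω

theorem tendsto_quotientBound {ω : Ω} (hδ : Tendsto (fun k => S.δ k ω) atTop (𝓝 0))
    (h₀ : Tendsto (fun k => |S.est₀ k ω - f (S.x k ω)| / S.δ k ω) atTop (𝓝 0))
    (hj : ∀ j, Tendsto (fun k => |S.est k j ω - f (S.pollPoint par.p_le_n k j ω)| / S.δ k ω)
      atTop (𝓝 0)) :
    Tendsto (quotientBound par S f ω) atTop (𝓝 0) := by
  have h := ((hδ.const_mul (-par.γ * par.εf)).sub h₀).sub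
    (tendsto_finsetSum Finset.univ fun j _ => hj j)
  simp only [mul_zero, sub_zero, Finset.sum_const_zero] at h
  exact h

variable [MeasurableSpace Ω] {P : Measure Ω}

/-- A feasible trial point at a failure misses the decrease test; replacing estimates by true values
costs the two errors. Summing over all j in `quotientBound` makes the bound independent of the
direction. -/
theorem quotientBound_mul_le (hS : IsStoDARS par X P S) {k : ℕ} {ω : Ω}
    (hk : k ∈ S.unsuccessful par X ω) {j : Fin m} (hj : S.pollPoint par.p_le_n k j ω ∈ X) :
    quotientBound par S f ω k * S.δ k ω ≤
      f (S.pollPoint par.p_le_n k j ω) - f (S.x k ω) := by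
  have hδ := hS.δ_pos k ω
  have h1 : -par.γ * par.εf * S.δ k ω ^ 2 < S.est k j ω - S.est₀ k ω := by
    by_contra hc
    exact hk ⟨j, hj, not_lt.1 hc⟩
  have h2 : |S.est k j ω - f (S.pollPoint par.p_le_n k j ω)| / S.δ k ω ≤
      ∑ j, |S.est k j ω - f (S.pollPoint par.p_le_n k j ω)| / S.δ k ω :=
    Finset.single_le_sum (f := fun j => |S.est k j ω - f (S.pollPoint par.p_le_n k j ω)| / S.δ k ω)
      (fun _ _ => div_nonneg (abs_nonneg _) hδ.le) (Finset.mem_univ j)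
  have h3 : quotientBound par S f ω k ≤ -par.γ * par.εf * S.δ k ω -
      |S.est₀ k ω - f (S.x k ω)| / S.δ k ω -
      |S.est k j ω - f (S.pollPoint par.p_le_n k j ω)| / S.δ k ω := by
    unfold quotientBound
    linarith
  have h4 := mul_le_mul_of_nonneg_right h3 hδ.le
  rw [sub_mul, sub_mul, div_mul_cancel₀ _ hδ.ne', div_mul_cancel₀ _ hδ.ne'] at h4
  have h5 := neg_abs_le (S.est₀ k ω - f (S.x k ω))
  have h6 := le_abs_self (S.est k j ω - f (S.pollPoint par.p_le_n k j ω))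
  nlinarith

/-- The generalized derivative at a refined point is nonnegative in every hypertangent direction
which is a limit of positive multiples of poll directions of unsuccessful iterations. -/
theorem clarkeJahn_nonneg_of_pollDir (hS : IsStoDARS par X P S) (hf : LocallyLipschitz f) {ω : Ω}
    (hδ : Tendsto (fun k => S.δ k ω) atTop (𝓝 0))
    (hquot : Tendsto (quotientBound par S f ω) atTop (𝓝 0)) {x u : Vec n}
    (hu : u ∈ hypertangentCone X x) {ι : Type*} {F : Filter ι} [F.NeBot] {κ : ι → ℕ}
    {J : ι → Fin m} {r : ℝ} (hr : 0 < r) (hκ : Tendsto κ F atTop)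
    (hunsucc : ∀ᶠ i in F, κ i ∈ S.unsuccessful par X ω)
    (hx : Tendsto (fun i => S.x (κ i) ω) F (𝓝 x))
    (hdir : Tendsto (fun i => r • S.pollDir par.p_le_n (κ i) (J i) ω) F (𝓝 u)) :
    0 ≤ clarkeJahn f X x u := by
  -- With step δ/r and direction r times the poll direction, the end point is exactly the trial
  -- point.
  refine clarkeJahn_nonneg_of_tendsto (h := fun i => S.δ (κ i) ω / r)
    (η := fun i => quotientBound par S f ω (κ i) * r) hf hu (fun i => hS.x_mem (κ i) ω) hx
    (fun i => div_pos (hS.δ_pos _ ω) hr) ?_ hdir ?_ ?_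
  · simpa using (hδ.comp hκ).div_const r
  · simpa using (hquot.comp hκ).mul_const r
  · filter_upwards [hunsucc] with i hi
    rw [smul_smul, div_mul_cancel₀ _ hr.ne', mul_assoc, mul_div_cancel₀ _ hr.ne']
    exact fun h => hS.quotientBound_mul_le hi h

/-- Stationarity from the density of the poll directions. -/
theorem isClarkeStationary_of_dense (hS : IsStoDARS par X P S) (hf : LocallyLipschitz f) {ω : Ω}
    (hδ : Tendsto (fun k => S.δ k ω) atTop (𝓝 0))
    (hquot : Tendsto (quotientBound par S f ω) atTop (𝓝 0)) {K : Set ℕ} {x : Vec n}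
    (hKu : K ⊆ S.unsuccessful par X ω) (hK : K.Infinite) (hxX : x ∈ X)
    (hx : Tendsto (fun k => S.x k ω) (alongSet K) (𝓝 x)) (j : Fin m)
    (hdense : ∀ v : Vec n, ‖v‖ = 1 → ∀ ε > 0,
      ∃ᶠ k in alongSet K, ‖S.pollDir par.p_le_n k j ω - v‖ < ε) :
    IsClarkeStationary f X x := by
  refine ⟨hxX, fun u hu => ?_⟩
  have hat : alongSet K ≤ atTop := inf_le_left
  have := neBot_alongSet hK
  have hmem : ∀ᶠ k in alongSet K, k ∈ K := mem_inf_of_right (mem_principal_self K)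
  rcases eq_or_ne u 0 with rfl | hu0
  · refine clarkeJahn_nonneg_of_tendsto (F := alongSet K) (y := fun _ => x) (w := fun _ => 0)
      (h := fun k => S.δ k ω) (η := fun _ => 0) hf hu (fun _ => hxX) tendsto_const_nhds
      (fun k => hS.δ_pos k ω) (hδ.mono_left hat) tendsto_const_nhds tendsto_const_nhds ?_
    simp
  · have hr : 0 < ‖u‖ := norm_pos_iff.2 hu0
    set v := ‖u‖⁻¹ • u with hv
    have hv1 : ‖v‖ = 1 := by rw [hv, norm_smul, norm_inv, norm_norm, inv_mul_cancel₀ hr.ne']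
    -- This filter plays the role of a subsequence of K along which the poll directions tend to v;
    -- density makes it nontrivial.
    set F := alongSet K ⊓ comap (fun k => S.pollDir par.p_le_n k j ω) (𝓝 v) with hF
    have hFK : F ≤ alongSet K := inf_le_left
    have : F.NeBot := by
      refine inf_neBot_iff_frequently_right.2 fun {q} hq => ?_
      obtain ⟨ε, hε, hball⟩ := (Metric.nhds_basis_ball.comap _).eventually_iff.1 hq
      refine (hdense v hv1 ε hε).mono fun k hk => hball ?_
      rwa [Set.mem_preimage, mem_ball_iff_norm]
    have hdir : Tendsto (fun k => S.pollDir par.p_le_n k j ω) F (𝓝 v) :=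
      tendsto_comap.mono_left inf_le_right
    refine hS.clarkeJahn_nonneg_of_pollDir (F := F) (κ := id) (J := fun _ => j) hf hδ hquot hu hr
      (hFK.trans hat) ((hmem.filter_mono hFK).mono fun k hk => hKu hk) (hx.mono_left hFK) ?_
    have h := hdir.const_smul ‖u‖
    rwa [hv, smul_inv_smul₀ hr.ne'] at h

end IsStoDARS

end

/-! ### The convergence theorem -/

theorem mainTheorem1 {Ω : Type*} [MeasurableSpace Ω] (P : Measure Ω) [IsProbabilityMeasure P]
    {n p m : ℕ} (par : StoDARSParams n p m) (X : Set (Vec n)) (f : Vec n → ℝ)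
    (S : StoDARSProcess Ω n p m) (hS : IsStoDARS par X P S)
    (hf_bdd : BddBelow (Set.range f)) (hf_lip : LocallyLipschitz f)
    (ν βf : ℝ) (hν : ν ∈ Set.Ioo (0 : ℝ) 1) (hβf : βf ∈ Set.Ioo (0 : ℝ) 1)
    (hντ : 2 * ((par.τ ^ 2)⁻¹ - 1) / (par.γ - 2) ≤ ν / (1 - ν))
    (hβν : 4 * ν / ((1 - ν) * (1 - par.τ ^ 2)) ≤ βf / (1 - βf))
    (hacc : ProbabilisticallyAccurate par f βf P S)
    (hvar : VarianceCondition par f βf P S) :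
    -- the unsuccessful iterations use all the matrices
    (∀ᵐ ω ∂P, ∀ s : ℕ, ∃ k ∈ S.unsuccessful par X ω, S.t k ω = s) ∧
    ∀ (K : Ω → Set ℕ) (xhat : Ω → Vec n),
      IsRefiningSubsequence par X P S K → ConvergesAlong X P S K xhat →
      -- directions that are limits of poll directions along a further subsequence
      (∀ (L : Ω → Set ℕ) (J : ℕ → Ω → Fin m) (uhat : Ω → Vec n),
        (∀ᵐ ω ∂P, L ω ⊆ K ω ∧ (L ω).Infinite ∧
          Tendsto (fun k => S.pollDir par.p_le_n k (J k ω) ω) (alongSet (L ω)) (𝓝 (uhat ω)) ∧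
          uhat ω ∈ hypertangentCone X (xhat ω)) →
        ∀ᵐ ω ∂P, 0 ≤ clarkeJahn f X (xhat ω) (uhat ω)) ∧
      -- all unit hypertangent directions, and stationarity
      (ExhaustsMatrices P S K →
        (∀ uhat : Ω → Vec n,
          (∀ᵐ ω ∂P, ‖uhat ω‖ = 1 ∧ uhat ω ∈ hypertangentCone X (xhat ω)) →
          ∀ᵐ ω ∂P, 0 ≤ clarkeJahn f X (xhat ω) (uhat ω)) ∧
        ∀ᵐ ω ∂P, IsClarkeStationary f X (xhat ω)) := by
  have hzero := hS.ae_tendsto_zero hβf.1 hacc hvar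
    (hS.exists_sum_integral_δ_sq_le hf_lip.continuous hf_bdd hν hβf hντ hβν hacc hvar) hβf.2
  refine ⟨?_, fun K xhat hK hx => ⟨?_, fun hex => ?_⟩⟩
  · filter_upwards [hzero] with ω hω s
    exact hS.exists_unsuccessful_index hω.1 s
  · intro L J uhat hL
    filter_upwards [hzero, hK, hx, hL] with ω ⟨hδ, h₀, hj⟩ ⟨hKu, _, _⟩ ⟨_, hxω⟩
      ⟨hLK, hLinf, hdir, hu⟩
    have := neBot_alongSet hLinf
    refine hS.clarkeJahn_nonneg_of_pollDir (F := alongSet (L ω)) (κ := id)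
      (J := fun k => J k ω) (r := 1) hf_lip hδ
      (IsStoDARS.tendsto_quotientBound hδ h₀ hj) hu one_pos inf_le_left ?_ ?_ ?_
    · exact mem_inf_of_right (mem_principal.2 (hLK.trans hKu))
    · exact hxω.mono_left (inf_le_inf_left _ (principal_mono.2 hLK))
    · simpa using hdir
  · have hstat : ∀ᵐ ω ∂P, IsClarkeStationary f X (xhat ω) := by
      have hmpos : 0 < m := by have := par.p_lt_m; omega
      filter_upwards [hzero, hK, hx, hex, hS.ae_forall_frequently_direction_near ⟨0, hmpos⟩]
        with ω ⟨hδ, h₀, hj⟩ ⟨hKu, hKinf, _⟩ ⟨hxX, hxω⟩ hexω hdense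
      exact hS.isClarkeStationary_of_dense hf_lip hδ (IsStoDARS.tendsto_quotientBound hδ h₀ hj)
        hKu hKinf hxX hxω ⟨0, hmpos⟩ fun v hv ε hε =>
          frequently_alongSet_of_frequently hexω (hdense v hv ε hε)
    -- Stationarity covers all hypertangent directions on one almost sure event, so a random
    -- direction needs no further argument.
    refine ⟨fun uhat hu => ?_, hstat⟩
    filter_upwards [hstat, hu] with ω h1 h2
    exact h1.2 _ h2.2
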